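/- Let $S$ be a smooth compact oriented surface without boundary, immersed in $\mathbb E^3$, with unit normal field $\mathbf n$, shape operator $S(q)=-d\mathbf n_q$, and put $$\mathcal K=\max_{q}\|S(q)\|_{\rm op},\qquad \mathcal K'=\max_q\max_{\|\mathbf v\|=1}\|\nabla_{\mathbf v}S(q)\|_{\rm op}.$$ A discrete net of curvature lines on $S$ is a cellular decomposition of $S$ whose attaching maps are homeomorphisms onto their images, in which any two closed cells are disjoint or meet in a single closed cell, whose edges are smoothly embedded segments of curvature lines, and in which non-umbilical vertices have valence four and umbilical vertices have valence greater than two. Let $p$ be a vertex of such a net. For a curved edge emanating from $p$, let the corresponding bold letter be the straight vector in $\mathbb E^3$ from $p$ to the other endpoint; two distinct edges emanating from $p$ and contained in a common 2-cell span a triangle of the vertex star of $p$. Let $\epsilon$ be the largest intrinsic length of a curved edge emanating from $p$, and let $\rho\ge1$ be the smallest number such that $\epsilon/\rho\le\|\mathbf e\|$ and $\|\mathbf e\|\|\mathbf f\|/\|\mathbf e\times\mathbf f\|\le\rho$ for all pairs $(\mathbf e,\mathbf f)$ spanning a triangle of the star (it is assumed that such a number exists). Assume the sampling condition $16\,\mathcal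 K\rho^2\epsilon\le 1$. Let $(\mathbf v_1,\mathbf v_2,\mathbf n)$ be a Darboux frame at $p$, i.e. $\mathbf v_1,\mathbf v_2$ are orthonormal principal directions at $p$ with principal curvatures $\kappa_1,\kappa_2$ and $\mathbf n=\mathbf v_1\times\mathbf v_2$ (if $p$ is umbilical, any positively oriented adapted orthonormal frame). Let each edge emanating from $p$ be associated with $\mathbf v_1$ or $\mathbf v_2$: with the one to which the curved edge is tangent at $p$ if $p$ is non-umbilical, and arbitrarily if $p$ is umbilical. The tangential deviation $u_d$ of an edge vector $\mathbf u$ is $|\mathbf u\cdot\mathbf v_2|$ if it is associated with $\mathbf v_1$, and $|\mathbf u\cdot\mathbf v_1|$ if it is associated with $\mathbf v_2$. Let $e,f,g$ emanate from $p$ such that $(\mathbf e,\mathbf f)$ and $(\mathbf e,\mathbf g)$ span triangles of the star, with $\mathbf n\cdot(\mathbf e\times\mathbf f)>0$ and $\mathbf n\cdot(\mathbf e\times\mathbf g)<0$. Let $\theta_e\in(-\pi,\pi)$ be the signed angle between the face normals $\mathbf e\times\mathbf f$ and $\mathbf g\times\mathbf e$, positive if the two triangles bend towards the side into which these normals point,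 and let $$k_e=2\sin\tfrac{\theta_e}{2}\,\|\mathbf e\|.$$ Let $A_e=\tfrac12\,\mathrm{sgn}(\star e)\,\|\mathbf e\|\,\|{\star e}\|$ be the circumcentric area, where, after unfolding the two triangles at $\mathbf e$ isometrically onto the plane on opposite sides of $\mathbf e$, $\star e$ is the segment joining their circumcenters $C_1,C_2$, and $\mathrm{sgn}(\star e)$ is positive if along the ray from $C_1$ through $C_2$ the first triangle lies before the second, negative if it lies after it. Then there is a constant $C=C(\mathcal K,\mathcal K',\rho)$, depending on nothing else, such that whenever $\mathbf e$ is associated with $\mathbf v_1$, and $\mathbf f,\mathbf g$ are associated with $\mathbf v_2$, $$\left|k_e-2A_e\kappa_2\right|\le C\left(\left|\delta_\kappa(e_d+f_d+g_d)\right|\epsilon+\epsilon^3\right),\qquad \delta_\kappa=\kappa_2-\kappa_1 .$$ -/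

import Mathlib

open scoped Manifold ContDiff

noncomputable section

/-! ## Euclidean space -/

/-- The Euclidean plane. -/
abbrev E2 : Type := EuclideanSpace ℝ (Fin 2)

/-- Euclidean three-space. -/
abbrev E3 : Type := EuclideanSpace ℝ (Fin 3)

/-- The cross product on Euclidean three-space. -/
def cross (u v : E3) : E3 := WithLp.toLp 2 (crossProduct (WithLp.ofLp u) (WithLp.ofLp v))

/-- The component of `u` orthogonal to the unit vector `n`, as a linear map in `u`. -/
def tangentialPart (n : E3) : E3 →ₗ[ℝ] E3 :=
  LinearMap.id - ((innerₛₗ ℝ n).smulRight n)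

/-! ## Oriented immersed surfaces -/

/-- A smooth surface `M` immersed into three-space; the orientation is recorded by a smooth
field of unit normals along the immersion. -/
structure OrientedImmersedSurface (M : Type*) [TopologicalSpace M] [ChartedSpace E2 M]
    [IsManifold (𝓡 2) ∞ M] where
  /-- The immersion. -/
  toFun : M → E3
  /-- The unit normal field. -/
  normal : M → E3
  contMDiff_toFun : ContMDiff (𝓡 2) 𝓘(ℝ, E3) ∞ toFun
  contMDiff_normal : ContMDiff (𝓡 2) 𝓘(ℝ, E3) ∞ normal
  injective_mfderiv : ∀ q, Function.Injective (mfderiv (𝓡 2) 𝓘(ℝ, E3) toFun q)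
  norm_normal : ∀ q, ‖normal q‖ = 1
  inner_normal : ∀ q (w : TangentSpace (𝓡 2) q),
    inner ℝ (normal q) (show E3 from mfderiv (𝓡 2) 𝓘(ℝ, E3) toFun q w) = 0

namespace OrientedImmersedSurface

variable {M : Type*} [TopologicalSpace M] [ChartedSpace E2 M] [IsManifold (𝓡 2) ∞ M]
  (S : OrientedImmersedSurface M)

/-- The directional derivative at `q` of a vector-valued function `Y` on the surface. -/
def dirDeriv (Y : M → E3) (q : M) : TangentSpace (𝓡 2) q →ₗ[ℝ] E3 :=
  (show TangentSpace (𝓡 2) q →L[ℝ] E3 from mfderiv (𝓡 2) 𝓘(ℝ, E3) Y q).toLinearMap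

/-- `u` is tangent to the surface at `q`, i.e. orthogonal to the normal. -/
def IsTangent (q : M) (u : E3) : Prop := inner ℝ (S.normal q) u = 0

/-- The shape operator `S(q)`: it sends the tangent vector `dF(w)` to `-dN(w)`, where `F` is the
immersion and `N` the unit normal. Tangent planes are regarded as subspaces of three-space, and
the operator is extended by `0` to the normal direction. -/
def shapeOperator (q : M) : E3 →ₗ[ℝ] E3 :=
  -(dirDeriv S.normal q ∘ₗ (dirDeriv S.toFun q).leftInverse ∘ₗ tangentialPart (S.normal q))

/-- The covariant (Levi-Civita) derivative at `q` along `w` of a tangential vector field `Y`: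
the tangential part of the ordinary derivative. -/
def covDeriv (Y : M → E3) (q : M) (w : TangentSpace (𝓡 2) q) : E3 :=
  tangentialPart (S.normal q) (dirDeriv Y q w)

/-- `(∇_w S) Y = ∇_w (S Y) - S (∇_w Y)` at `q`, for a tangential vector field `Y`. -/
def covDerivShape (q : M) (w : TangentSpace (𝓡 2) q) (Y : M → E3) : E3 :=
  S.covDeriv (fun x => S.shapeOperator x (Y x)) q w - S.shapeOperator q (S.covDeriv Y q w)

/-- `K = max_q ‖S(q)‖`, the maximal operator norm of the shape operator. -/
def IsCurvatureBound (K : ℝ) : Prop :=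
  IsGreatest {r | ∃ (q : M) (u : E3), S.IsTangent q u ∧ ‖u‖ = 1 ∧ r = ‖S.shapeOperator q u‖} K

/-- `K' = max_q max_{‖w‖ = 1} ‖∇_w S(q)‖`, the maximal operator norm of the covariant derivative
of the shape operator. -/
def IsCurvatureDerivBound (K' : ℝ) : Prop :=
  IsGreatest {r | ∃ (q : M) (w : TangentSpace (𝓡 2) q) (Y : M → E3),
    ContMDiff (𝓡 2) 𝓘(ℝ, E3) ∞ Y ∧ (∀ x, S.IsTangent x (Y x)) ∧
    ‖dirDeriv S.toFun q w‖ = 1 ∧ ‖Y q‖ = 1 ∧ r = ‖S.covDerivShape q w Y‖} K'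

/-- The point `q` is umbilical. -/
def IsUmbilic (q : M) : Prop := ∃ c : ℝ, ∀ u, S.IsTangent q u → S.shapeOperator q u = c • u

/-- `(v 0, v 1, N)` is a Darboux frame at `q`: a positively oriented adapted orthonormal frame
consisting of principal directions, with principal curvatures `κ 0`, `κ 1`. (At an umbilic this
is any positively oriented adapted orthonormal frame.) -/
structure IsDarbouxFrame (q : M) (v : Fin 2 → E3) (κ : Fin 2 → ℝ) : Prop where
  orthonormal : Orthonormal ℝ v
  cross_eq : cross (v 0) (v 1) = S.normal q
  principal : ∀ i, S.shapeOperator q (v i) = κ i • v i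

end OrientedImmersedSurface

/-! ## Discrete nets -/

section Nets

open Topology

variable {M : Type*} [TopologicalSpace M]

/-- The `n`-cells of a cell decomposition of `M`. -/
abbrev Cell (M : Type*) [TopologicalSpace M] [CWComplex (Set.univ : Set M)] (n : ℕ) : Type _ :=
  RelCWComplex.cell (Set.univ : Set M) n

/-- The vertices (0-cells). -/
abbrev Vertex (M : Type*) [TopologicalSpace M] [CWComplex (Set.univ : Set M)] : Type _ := Cell M 0

/-- The edges (1-cells). -/
abbrev Edge (M : Type*) [TopologicalSpace M] [CWComplex (Set.univ : Set M)] : Type _ := Cell M 1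

/-- The 2-cells. -/
abbrev Face (M : Type*) [TopologicalSpace M] [CWComplex (Set.univ : Set M)] : Type _ := Cell M 2

/-- The characteristic map of a cell; the model of a closed `n`-cell is the cube `[-1, 1]ⁿ`. -/
abbrev charMap [CWComplex (Set.univ : Set M)] (n : ℕ) (i : Cell M n) : (Fin n → ℝ) → M :=
  RelCWComplex.map (C := Set.univ) n i

/-- The closed cell, as a subset of `M`. -/
abbrev closedCell [CWComplex (Set.univ : Set M)] (n : ℕ) (i : Cell M n) : Set M :=
  RelCWComplex.closedCell (C := Set.univ) n i

/-- The edge `e` of a cell decomposition of `M` as a curve defined on `[-1, 1]`. -/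
def edgeCurve [CWComplex (Set.univ : Set M)]
    (e : Edge M) (t : ℝ) : M :=
  charMap 1 e (fun _ => t)

/-- The point of `M` at the vertex `x` of a cell decomposition. -/
def vertexPoint [CWComplex (Set.univ : Set M)]
    (x : Vertex M) : M :=
  charMap 0 x 0

/-- The edge `e` emanates from the vertex `x`. -/
def Emanates [CWComplex (Set.univ : Set M)] (x : Vertex M)
    (e : Edge M) : Prop :=
  edgeCurve e (-1) = vertexPoint x ∨ edgeCurve e 1 = vertexPoint x

/-- The distinct edges `e` and `f` both emanate from `x` and lie in a common 2-cell. -/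
def SpanStarTriangle [CWComplex (Set.univ : Set M)] (x : Vertex M)
    (e f : Edge M) : Prop :=
  e ≠ f ∧ Emanates x e ∧ Emanates x f ∧
    ∃ c : Face M,
      closedCell 1 e ⊆ closedCell 2 c ∧
      closedCell 1 f ⊆ closedCell 2 c

variable [ChartedSpace E2 M] [IsManifold (𝓡 2) ∞ M] [CWComplex (Set.univ : Set M)]
  (S : OrientedImmersedSurface M)

/-- The velocity in three-space of the edge curve of `e`. -/
def edgeVelocity (e : Edge M) (t : ℝ) : E3 :=
  derivWithin (fun s => S.toFun (edgeCurve e s)) (Set.Icc (-1) 1) t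

/-- A cell decomposition of the surface is a discrete net of curvature lines. -/
structure IsCurvatureLineNet : Prop where
  /-- There are only vertices, edges and 2-cells. -/
  dim_le_two : ∀ n, 2 < n → IsEmpty (Cell M n)
  /-- The attaching maps are homeomorphisms onto their images. -/
  attaching_injOn : ∀ n (i : Cell M n),
    Set.InjOn (charMap n i) (Metric.sphere 0 1)
  /-- Two closed cells are disjoint or intersect in a single closed cell. -/
  inter_cells : ∀ m n (i : Cell M m)
    (j : Cell M n),
    closedCell m i ∩ closedCell n j = ∅ ∨
    ∃ (l : ℕ) (k : Cell M l),
      closedCell m i ∩ closedCell n j =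
        closedCell l k
  /-- Edges are smooth, up to and including their endpoints. -/
  edge_smooth : ∀ e : Edge M,
    ContMDiffOn 𝓘(ℝ, ℝ) (𝓡 2) ∞ (edgeCurve e) (Set.Icc (-1) 1)
  /-- Edges are regular curves. -/
  edge_regular : ∀ (e : Edge M), ∀ t ∈ Set.Icc (-1 : ℝ) 1,
    edgeVelocity S e t ≠ 0
  /-- Edges are segments of curvature lines: their tangents are principal directions. -/
  edge_principal : ∀ (e : Edge M), ∀ t ∈ Set.Icc (-1 : ℝ) 1,
    ∃ c : ℝ, S.shapeOperator (edgeCurve e t) (edgeVelocity S e t) = c • edgeVelocity S e t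
  /-- Non-umbilical vertices have valence four. -/
  valence_of_not_umbilic : ∀ x : Vertex M,
    ¬ S.IsUmbilic (vertexPoint x) → {e | Emanates x e}.encard = 4
  /-- Umbilical vertices have valence greater than two. -/
  valence_of_umbilic : ∀ x : Vertex M,
    S.IsUmbilic (vertexPoint x) → 2 < {e | Emanates x e}.encard

open Classical in
/-- The straight edge vector of an edge `e` emanating from `x`, pointing away from `x`. -/
def edgeVector (x : Vertex M)
    (e : Edge M) : E3 :=
  if edgeCurve e (-1) = vertexPoint x
  then S.toFun (edgeCurve e 1) - S.toFun (vertexPoint x)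
  else S.toFun (edgeCurve e (-1)) - S.toFun (vertexPoint x)

open Classical in
/-- A tangent vector at `x` of the curved edge `e` emanating from `x`. -/
def edgeTangent (x : Vertex M)
    (e : Edge M) : E3 :=
  if edgeCurve e (-1) = vertexPoint x then edgeVelocity S e (-1) else edgeVelocity S e 1

/-- The intrinsic length of the curved edge `e`. -/
def edgeLength (e : Edge M) : ℝ :=
  ∫ t in (-1 : ℝ)..1, ‖edgeVelocity S e t‖

/-- `ε` is the largest intrinsic length of an edge emanating from `x`. -/
def IsMaxEdgeLength (x : Vertex M) (ε : ℝ) : Prop :=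
  IsGreatest {r | ∃ e, Emanates x e ∧ r = edgeLength S e} ε

/-- `ρ ≥ 1` is the shape regularity at `x`, where `ε` is the largest edge length at `x`. (Pairs of
parallel edge vectors admit no finite shape regularity.) -/
def IsShapeRegularity (x : Vertex M) (ε ρ : ℝ) : Prop :=
  IsLeast {r | 1 ≤ r ∧ ∀ e f, SpanStarTriangle x e f →
    ε / r ≤ ‖edgeVector S x e‖ ∧
    0 < ‖cross (edgeVector S x e) (edgeVector S x f)‖ ∧
    ‖edgeVector S x e‖ * ‖edgeVector S x f‖ /
      ‖cross (edgeVector S x e) (edgeVector S x f)‖ ≤ r} ρ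

/-- `a` associates each edge emanating from `x` with one of the directions `v 0`, `v 1` of a
Darboux frame at `x`: at a non-umbilical vertex, with the principal direction to which the edge
is tangent; at an umbilical vertex, arbitrarily. -/
def IsAssociation (x : Vertex M) (v : Fin 2 → E3)
    (a : Edge M → Fin 2) : Prop :=
  ¬ S.IsUmbilic (vertexPoint x) → ∀ e, Emanates x e →
    ∃ c : ℝ, edgeTangent S x e = c • v (a e)

end Nets

/-- The tangential deviation of a vector `u` associated with the direction `v i` of a Darboux
frame: the absolute value of its coordinate along the other direction. -/
def tangentialDeviation (v : Fin 2 → E3) (i : Fin 2) (u : E3) : ℝ :=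
  if i = 0 then |inner ℝ (v 1) u| else |inner ℝ (v 0) u|

/-! ## Two triangles with a common edge

The triangles `(0, e, f)` and `(0, e, g)` have the common edge `e`; they are oriented by the
normals `e × f` and `g × e`, so that `f` lies to the left of `e` and `g` to the right. -/

/-- The signed angle between the normals `e × f` and `g × e` of the two triangles, positive if
the surface bends towards the side into which the normals point. -/
def dihedralAngle (e f g : E3) : ℝ :=
  Real.sign (inner ℝ (cross (cross g e) (cross e f)) e) *
    InnerProductGeometry.angle (cross e f) (cross g e)

/-- The edge-based integrated curvature `2 sin(θ/2) ‖e‖`. -/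
def integratedCurvature (e f g : E3) : ℝ :=
  2 * Real.sin (dihedralAngle e f g / 2) * ‖e‖

open Classical in
/-- The circumcenter of a planar triangle (`0` if the triangle is degenerate). -/
def circumcenter (a b c : E2) : E2 :=
  if h : AffineIndependent ℝ ![a, b, c] then
    Affine.Simplex.circumcenter (⟨![a, b, c], h⟩ : Affine.Simplex ℝ E2 2)
  else 0

/-- The circumcenter of the triangle `(0, e, f)` after unfolding it isometrically onto the plane,
with `e` on the positive first axis and `f` in the upper half-plane. -/
def upperCircumcenter (e f : E3) : E2 :=
  circumcenter 0 !₂[‖e‖, 0] !₂[inner ℝ e f / ‖e‖, ‖cross e f‖ / ‖e‖]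

/-- The circumcenter of the triangle `(0, e, g)` after unfolding it isometrically onto the plane,
with `e` on the positive first axis and `g` in the lower half-plane. -/
def lowerCircumcenter (e g : E3) : E2 :=
  circumcenter 0 !₂[‖e‖, 0] !₂[inner ℝ e g / ‖e‖, -(‖cross e g‖ / ‖e‖)]

/-- The circumcentric area `½ sgn(⋆e) ‖e‖ ‖⋆e‖` of the edge `e`. The dual edge `⋆e` joins the
circumcenters of the two unfolded triangles; it counts positively if, going from the circumcenter
of the upper triangle to that of the lower one, the upper triangle comes first. -/
def circumcentricArea (e f g : E3) : ℝ :=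
  1 / 2 * Real.sign (upperCircumcenter e f 1 - lowerCircumcenter e g 1) * ‖e‖ *
    dist (upperCircumcenter e f) (lowerCircumcenter e g)

end

/-! ## The shape operator as a smooth field of operators -/

/-! Let e₁, e₂, e₃ be the coordinates of e in the Darboux frame, and let Q = ‖e × f‖, R = ‖e × g‖, D
= g·(e × f), δ = κ₂ − κ₁.

To third order the edges at p end on the osculating paraboloid. Integrating the Weingarten equation
N' = −A c' along an edge gives e₃ = ½(κ₁e₁² + κ₂e₂²) + O(ε³) (`height_estimates`). The constant
comes from the bound K' + 2K² on the derivative of the shape operator as a field of operators on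
space (`norm_shapeDeriv_le`).

The rest is algebra of three vectors. Since sin θ_e = ‖e‖ D/(QR), the curvature k_e is ‖e‖² D/(QR)
up to a cubic error in sin θ_e (`abs_integratedCurvature_sub_le`). Expanding D along n splits
D/(QR), up to a relative error O(ε²), into one term per triangle, Z_f + Z_g with Z_f = (f₃ −
(e·f/‖e‖²) e₃)/Q. The cotangent formula gives 2A_e = ½‖e‖²(W_f + W_g), where W_f = (‖f‖² − e·f)/Q is
the cotangent of the angle opposite e (`circumcentricArea_eq`).

It remains to compare Z_f with ½κ₂W_f (`triangle_height_estimate`). If δ = 0, then e₃ ≈ ½κ₂‖e‖² and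
f₃ ≈ ½κ₂‖f‖², and the two agree to the required order. In general the numerators differ further by
½δ(−f₁² + (e·f)e₁²/‖e‖²). Here f₁² ≤ |f₁|ε, and e·f = e₁f₁ + e₂f₂ + e₃f₃ is at most (|f₁| + |e₂|)ε
up to a term of order four; f₁ and e₂ are, up to sign, the tangential deviations.

The sampling condition keeps both face normals close to n, so |θ_e| < π/2 and the ratios of
projected to true areas stay close to 1. -/

theorem tangentialPart_apply (n u : E3) : tangentialPart n u = u - inner ℝ n u • n := rfl

theorem tangentialPart_of_inner_eq_zero {n u : E3} (h : inner ℝ n u = 0) :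
    tangentialPart n u = u := by
  simp [tangentialPart_apply, h]

theorem tangentialPart_self {n : E3} (h : ‖n‖ = 1) : tangentialPart n n = 0 := by
  simp [tangentialPart_apply, h]

theorem inner_tangentialPart {n : E3} (h : ‖n‖ = 1) (u : E3) :
    inner ℝ n (tangentialPart n u) = 0 := by
  simp [tangentialPart_apply, inner_sub_right, inner_smul_right, h]

theorem norm_sq_tangentialPart {n : E3} (h : ‖n‖ = 1) (u : E3) :
    ‖tangentialPart n u‖ ^ 2 = ‖u‖ ^ 2 - inner ℝ n u ^ 2 := by
  rw [tangentialPart_apply, norm_sub_sq_real, inner_smul_right, norm_smul, h, real_inner_comm,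
    Real.norm_eq_abs, mul_one, sq_abs]
  ring

theorem norm_tangentialPart_le {n : E3} (h : ‖n‖ = 1) (u : E3) : ‖tangentialPart n u‖ ≤ ‖u‖ := by
  have := norm_sq_tangentialPart h u
  exact le_of_sq_le_sq (by nlinarith [sq_nonneg (inner ℝ n u)]) (norm_nonneg u)

/-- In a chart, the manifold derivative of a vector-valued map is its Fréchet derivative. -/
theorem exists_hasFDerivAt_comp_extChartAt_symm {V : Type*} [NormedAddCommGroup V]
    [NormedSpace ℝ V] {M : Type*} [TopologicalSpace M] [ChartedSpace E2 M] {f : M → V}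
    {q : M} (hf : MDifferentiableAt (𝓡 2) 𝓘(ℝ, V) f q) :
    ∃ L : E2 →L[ℝ] V, HasFDerivAt (f ∘ (extChartAt (𝓡 2) q).symm) L (extChartAt (𝓡 2) q q) ∧
      L = mfderiv (𝓡 2) 𝓘(ℝ, V) f q := by
  obtain ⟨L, hL⟩ : ∃ L : E2 →L[ℝ] V, L = mfderiv (𝓡 2) 𝓘(ℝ, V) f q := ⟨_, rfl⟩
  refine ⟨L, ?_, hL⟩
  have h : HasFDerivWithinAt (writtenInExtChartAt (𝓡 2) 𝓘(ℝ, V) q f) L (Set.range (𝓡 2))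
      (extChartAt (𝓡 2) q q) := hL ▸ hf.hasMFDerivAt.2
  rwa [ModelWithCorners.range_eq_univ, hasFDerivWithinAt_univ] at h

theorem eq_mfderiv_of_hasFDerivAt_comp_extChartAt_symm {V : Type*} [NormedAddCommGroup V]
    [NormedSpace ℝ V] {M : Type*} [TopologicalSpace M] [ChartedSpace E2 M] {f : M → V}
    {q : M}
    (hf : MDifferentiableAt (𝓡 2) 𝓘(ℝ, V) f q) {L : E2 →L[ℝ] V}
    (hL : HasFDerivAt (f ∘ (extChartAt (𝓡 2) q).symm) L (extChartAt (𝓡 2) q q)) :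
    L = mfderiv (𝓡 2) 𝓘(ℝ, V) f q := by
  obtain ⟨L', h1, h2⟩ := exists_hasFDerivAt_comp_extChartAt_symm hf
  rw [← h2]
  exact hL.unique h1

namespace OrientedImmersedSurface

variable {M : Type*} [TopologicalSpace M] [ChartedSpace E2 M] [IsManifold (𝓡 2) ∞ M]
  (S : OrientedImmersedSurface M)

/-- The Weingarten equation. Injectivity of the differential is what makes `leftInverse` a genuine
left inverse. -/
theorem shapeOperator_dirDeriv (q : M) (w : TangentSpace (𝓡 2) q) :
    S.shapeOperator q (dirDeriv S.toFun q w) = -dirDeriv S.normal q w := by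
  have hinj : Function.Injective (dirDeriv S.toFun q) := S.injective_mfderiv q
  have h0 : inner ℝ (S.normal q) (dirDeriv S.toFun q w) = 0 := S.inner_normal q w
  have h1 : (dirDeriv S.toFun q).leftInverse (dirDeriv S.toFun q w) = w :=
    LinearMap.leftInverse_apply_of_inj (LinearMap.ker_eq_bot.mpr hinj) w
  simp [shapeOperator, tangentialPart_of_inner_eq_zero h0, h1]

theorem shapeOperator_normal (q : M) : S.shapeOperator q (S.normal q) = 0 := by
  simp [shapeOperator, tangentialPart_self (S.norm_normal q)]

theorem shapeOperator_tangentialPart (q : M) (u : E3) :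
    S.shapeOperator q (tangentialPart (S.normal q) u) = S.shapeOperator q u := by
  rw [tangentialPart_apply, map_sub, map_smul, shapeOperator_normal]
  simp

theorem mdifferentiable_normal : MDifferentiable (𝓡 2) 𝓘(ℝ, E3) S.normal :=
  S.contMDiff_normal.mdifferentiable (by simp)

theorem mdifferentiable_toFun : MDifferentiable (𝓡 2) 𝓘(ℝ, E3) S.toFun :=
  S.contMDiff_toFun.mdifferentiable (by simp)

/-- Differentiate ⟨N, N⟩ = 1 in a chart. -/
theorem inner_normal_dirDeriv_normal (q : M) (w : TangentSpace (𝓡 2) q) :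
    inner ℝ (S.normal q) (dirDeriv S.normal q w) = 0 := by
  obtain ⟨L, h, hL⟩ := exists_hasFDerivAt_comp_extChartAt_symm (S.mdifferentiable_normal q)
  have h1 := h.inner ℝ h
  have h2 : (fun y => inner ℝ ((S.normal ∘ (extChartAt (𝓡 2) q).symm) y)
      ((S.normal ∘ (extChartAt (𝓡 2) q).symm) y)) = fun _ => (1 : ℝ) := by
    ext y
    simp [S.norm_normal]
  rw [h2] at h1
  obtain ⟨w', hw⟩ : ∃ w' : E2, w' = w := ⟨_, rfl⟩
  have h3 := congrArg (fun L : E2 →L[ℝ] ℝ => L w') (h1.unique (hasFDerivAt_const _ _))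
  simp only [ContinuousLinearMap.comp_apply, ContinuousLinearMap.prod_apply, fderivInnerCLM_apply,
    Function.comp_apply, extChartAt_to_inv, zero_apply, real_inner_comm (S.normal q) (L w')] at h3
  have h4 : dirDeriv S.normal q w = L w' := by rw [hL, hw]; rfl
  rw [h4]
  linarith

theorem inner_normal_shapeOperator (q : M) (u : E3) :
    inner ℝ (S.normal q) (S.shapeOperator q u) = 0 := by
  simp only [shapeOperator, LinearMap.neg_apply, LinearMap.comp_apply, inner_neg_right,
    inner_normal_dirDeriv_normal, neg_zero]

/-- The shape operator as a continuous linear map. -/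
noncomputable def shapeCLM (q : M) : E3 →L[ℝ] E3 :=
  LinearMap.toContinuousLinearMap (S.shapeOperator q)

@[simp]
theorem shapeCLM_apply (q : M) (u : E3) : S.shapeCLM q u = S.shapeOperator q u := rfl

/-- In local coordinates the derivative of a smooth map depends smoothly on the point. -/
theorem exists_contMDiffAt_dirDeriv (q : M) :
    ∃ T : M → E2 →L[ℝ] E2, T q = ContinuousLinearMap.id ℝ E2 ∧
      ∀ G : M → E3, ContMDiff (𝓡 2) 𝓘(ℝ, E3) ∞ G → ∃ D : M → E2 →L[ℝ] E3,
        ContMDiffAt (𝓡 2) 𝓘(ℝ, E2 →L[ℝ] E3) 1 D q ∧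
        ∀ᶠ x in nhds q, ∀ w, D x w = dirDeriv G x (T x w) := by
  have hM : IsManifold (𝓡 2) 1 M := IsManifold.of_le (n := ∞) (by simp)
  -- `mfderiv` at x is written in the preferred chart at x, which may jump with x. The witness T x
  -- passes from the chart at q to the chart at x, so that dG ∘ T is written in one fixed chart; it
  -- does not depend on G.
  refine ⟨fun x => (tangentBundleCore (𝓡 2) M).coordChange (achart _ q) (achart _ x) x, ?_,
    fun G hG => ⟨_, (hG q).mfderiv_const (m := 1) (by norm_cast), ?_⟩⟩
  · ext1 w
    exact (tangentBundleCore (𝓡 2) M).coordChange_self _ _ (mem_achart_source _ q) w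
  · filter_upwards [(chartAt (EuclideanSpace ℝ (Fin 2)) q).open_source.mem_nhds
      (mem_chart_source _ q)] with x hx w
    have h := inTangentCoordinates_eq (I := 𝓡 2) (I' := 𝓘(ℝ, E3)) id G
      (fun x => mfderiv (𝓡 2) 𝓘(ℝ, E3) G x) (x₀ := q) (x := x) hx (Set.mem_univ (G x))
    rw [tangentBundleCore_coordChange_model_space] at h
    exact congrArg (fun L : E2 →L[ℝ] E3 => L w) h

/-- A left inverse chosen pointwise need not visibly depend smoothly on the point. But P(w, t) =
dF(w) + t N is an isomorphism depending smoothly on the point, and the shape operator satisfies A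
P(w, t) = −dN(w). Hence A = −(dN ∘ fst) ∘ P⁻¹ near q, and inversion of operators is smooth. -/
theorem mdifferentiableAt_shapeCLM (q : M) :
    MDifferentiableAt (𝓡 2) 𝓘(ℝ, E3 →L[ℝ] E3) S.shapeCLM q := by
  obtain ⟨T, hTq, hT⟩ := exists_contMDiffAt_dirDeriv q
  obtain ⟨D, hD, hDe⟩ := hT _ S.contMDiff_toFun
  obtain ⟨R, hR, hRe⟩ := hT _ S.contMDiff_normal
  let fr (L : E2 →L[ℝ] E3) (n : E3) : E2 × ℝ →L[ℝ] E3 :=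
    L ∘L ContinuousLinearMap.fst ℝ E2 ℝ + (ContinuousLinearMap.snd ℝ E2 ℝ).smulRight n
  have hfr : ∀ L n w t, fr L n (w, t) = L w + t • n := fun L n w t => rfl
  let P : M → E2 × ℝ →L[ℝ] E3 := fun x => fr (D x) (S.normal x)
  have hP : ContMDiffAt (𝓡 2) 𝓘(ℝ, E2 × ℝ →L[ℝ] E3) 1 P q := by
    have h1 : ContDiff ℝ 1 (fun z : (E2 →L[ℝ] E3) × E3 => fr z.1 z.2) := by
      have : ContDiff ℝ 1 (fun z : (E2 →L[ℝ] E3) × E3 =>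
          ContinuousLinearMap.smulRightL ℝ (E2 × ℝ) E3 (ContinuousLinearMap.snd ℝ E2 ℝ) z.2) := by
        fun_prop
      exact (contDiff_fst.clm_comp contDiff_const).add this
    exact h1.contDiffAt.contMDiffAt.comp q
      (hD.prodMk_space ((S.contMDiff_normal q).of_le (by norm_cast)))
  have hinj : Function.Injective (P q) := by
    rw [injective_iff_map_eq_zero]
    rintro ⟨w, t⟩ h
    rw [hfr, hDe.self_of_nhds w, hTq] at h
    have h0 : inner ℝ (S.normal q) (dirDeriv S.toFun q w) = 0 := S.inner_normal q w
    have ht : t = 0 := by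
      have := congrArg (fun u => inner ℝ (S.normal q) u) h
      simpa [inner_add_right, inner_smul_right, S.norm_normal, h0] using this
    subst ht
    have hw : dirDeriv S.toFun q w = dirDeriv S.toFun q 0 := by simpa using h
    have : w = 0 := S.injective_mfderiv q hw
    simp [this]
  let Φ : (E2 × ℝ) ≃L[ℝ] E3 := (LinearEquiv.ofInjectiveOfFinrankEq (P q).toLinearMap hinj
    (by simp)).toContinuousLinearEquiv
  have hΦ : (Φ : E2 × ℝ →L[ℝ] E3) = P q := ContinuousLinearMap.ext fun _ => rfl
  have hinv : ContMDiffAt (𝓡 2) 𝓘(ℝ, E3 →L[ℝ] E2 × ℝ) 1 (fun x => (P x).inverse) q := by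
    have h1 : ContDiffAt ℝ 1 ContinuousLinearMap.inverse (P q) := hΦ ▸ contDiffAt_map_inverse Φ
    exact h1.contMDiffAt.comp q hP
  have hQ : ContMDiffAt (𝓡 2) 𝓘(ℝ, E3 →L[ℝ] E3) 1
      (fun x => (-(R x ∘L ContinuousLinearMap.fst ℝ E2 ℝ)) ∘L (P x).inverse) q :=
    (hR.clm_comp contMDiffAt_const).neg.clm_comp hinv
  refine (hQ.mdifferentiableAt one_ne_zero).congr_of_eventuallyEq ?_
  -- Invertibility is an open condition, so P stays invertible near q.
  have hev : ∀ᶠ x in nhds q, P x ∈ Set.range ContinuousLinearEquiv.toContinuousLinearMap :=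
    hP.continuousAt.eventually (hΦ ▸ Φ.nhds)
  filter_upwards [hev, hDe, hRe] with x ⟨Ψ, hΨ⟩ h1 h2
  have key : S.shapeCLM x ∘L P x = -(R x ∘L ContinuousLinearMap.fst ℝ E2 ℝ) := by
    refine ContinuousLinearMap.ext fun ⟨w, t⟩ => ?_
    have := S.shapeOperator_dirDeriv x (T x w)
    simpa [P, hfr, h1, h2, shapeOperator_normal] using this
  rw [← key, ← hΨ]
  ext1 u
  simp

/-- The derivative of the field of shape operators in a chart. -/
theorem exists_hasFDerivAt_shapeCLM (q : M) :
    ∃ L : E2 →L[ℝ] E3 →L[ℝ] E3,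
      HasFDerivAt (S.shapeCLM ∘ (extChartAt (𝓡 2) q).symm) L (extChartAt (𝓡 2) q q) ∧
      L = mfderiv (𝓡 2) 𝓘(ℝ, E3 →L[ℝ] E3) S.shapeCLM q :=
  exists_hasFDerivAt_comp_extChartAt_symm (S.mdifferentiableAt_shapeCLM q)

end OrientedImmersedSurface

namespace OrientedImmersedSurface

variable {M : Type*} [TopologicalSpace M] [ChartedSpace E2 M] [IsManifold (𝓡 2) ∞ M]
  {S : OrientedImmersedSurface M} {K K' : ℝ}

/-! ## Bounds for the shape operator and its derivative -/

theorem IsCurvatureBound.nonneg (hK : S.IsCurvatureBound K) : 0 ≤ K := by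
  obtain ⟨q, u, -, -, h⟩ := hK.1
  exact h ▸ norm_nonneg _

theorem IsCurvatureDerivBound.nonneg (hK' : S.IsCurvatureDerivBound K') : 0 ≤ K' := by
  obtain ⟨q, w, Y, -, -, -, -, h⟩ := hK'.1
  exact h ▸ norm_nonneg _

theorem IsCurvatureBound.norm_shapeOperator_le (hK : S.IsCurvatureBound K) (q : M) (u : E3) :
    ‖S.shapeOperator q u‖ ≤ K * ‖u‖ := by
  -- The hypothesis speaks of unit tangent vectors only: scale, then project a general vector to the
  -- tangent plane.
  have key : ∀ u, S.IsTangent q u → ‖S.shapeOperator q u‖ ≤ K * ‖u‖ := by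
    intro u hu
    rcases eq_or_ne u 0 with rfl | h0
    · simp
    have hpos : 0 < ‖u‖ := norm_pos_iff.mpr h0
    have hu' : S.IsTangent q (‖u‖⁻¹ • u) := by
      have : inner ℝ (S.normal q) u = 0 := hu
      simp [IsTangent, inner_smul_right, this]
    have h := hK.2 ⟨q, ‖u‖⁻¹ • u, hu', by simp [norm_smul, hpos.ne'], rfl⟩
    rw [map_smul, norm_smul, norm_inv, norm_norm] at h
    rwa [inv_mul_le_iff₀ hpos, mul_comm] at h
  rw [← shapeOperator_tangentialPart]
  exact (key _ (inner_tangentialPart (S.norm_normal q) u)).trans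
    (mul_le_mul_of_nonneg_left (norm_tangentialPart_le (S.norm_normal q) u) hK.nonneg)

theorem IsCurvatureBound.norm_dirDeriv_normal_le (hK : S.IsCurvatureBound K) (q : M)
    (w : TangentSpace (𝓡 2) q) :
    ‖dirDeriv S.normal q w‖ ≤ K * ‖dirDeriv S.toFun q w‖ := by
  have h := hK.norm_shapeOperator_le q (dirDeriv S.toFun q w)
  rwa [shapeOperator_dirDeriv, norm_neg] at h

/-- The directional derivative at `q` of the shape operator, regarded as a field of operators
on three-space. -/
noncomputable def shapeDeriv (S : OrientedImmersedSurface M) (q : M) :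
    TangentSpace (𝓡 2) q →ₗ[ℝ] E3 →L[ℝ] E3 :=
  (show E2 →L[ℝ] E3 →L[ℝ] E3 from
    mfderiv (𝓡 2) 𝓘(ℝ, E3 →L[ℝ] E3) S.shapeCLM q).toLinearMap

theorem dirDeriv_shapeOperator_apply (q : M) (w : TangentSpace (𝓡 2) q) (u : E3) :
    dirDeriv (fun x => S.shapeOperator x u) q w = S.shapeDeriv q w u := by
  obtain ⟨L, h, hL⟩ := S.exists_hasFDerivAt_shapeCLM q
  have h1 := h.clm_apply (hasFDerivAt_const u _)
  have hd : MDifferentiableAt (𝓡 2) 𝓘(ℝ, E3) (fun x => S.shapeCLM x u) q :=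
    (S.mdifferentiableAt_shapeCLM q).clm_apply mdifferentiableAt_const
  have h2 := eq_mfderiv_of_hasFDerivAt_comp_extChartAt_symm hd h1
  obtain ⟨w', hw⟩ : ∃ w' : E2, w' = w := ⟨_, rfl⟩
  have h3 : dirDeriv (fun x => S.shapeOperator x u) q w = L w' u := by
    have := congrArg (fun L : E2 →L[ℝ] E3 => L w') h2
    simp at this
    rw [this, hw]
    rfl
  have h4 : S.shapeDeriv q w u = L w' u := by rw [hL, hw]; rfl
  rw [h3, h4]

/-- Differentiate A N = 0. -/
theorem shapeDeriv_normal (q : M) (w : TangentSpace (𝓡 2) q) :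
    S.shapeDeriv q w (S.normal q) = -S.shapeOperator q (dirDeriv S.normal q w) := by
  obtain ⟨L, h, hL⟩ := S.exists_hasFDerivAt_shapeCLM q
  obtain ⟨N, hN, hNL⟩ := exists_hasFDerivAt_comp_extChartAt_symm (S.mdifferentiable_normal q)
  have h1 := h.clm_apply hN
  have h2 : (fun y => (S.shapeCLM ∘ (extChartAt (𝓡 2) q).symm) y
      ((S.normal ∘ (extChartAt (𝓡 2) q).symm) y)) = fun _ => (0 : E3) := by
    ext1 y
    simp [shapeOperator_normal]
  rw [h2] at h1
  obtain ⟨w', hw⟩ : ∃ w' : E2, w' = w := ⟨_, rfl⟩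
  have h3 := congrArg (fun L : E2 →L[ℝ] E3 => L w') (h1.unique (hasFDerivAt_const _ _))
  have h4 : S.shapeDeriv q w = L w' := by rw [hL, hw]; rfl
  have h5 : dirDeriv S.normal q w = N w' := by rw [hNL, hw]; rfl
  rw [h4, h5]
  simp at h3
  rw [add_comm] at h3
  exact eq_neg_of_add_eq_zero_left h3

/-- Differentiate ⟨N, A u⟩ = 0 with u constant. -/
theorem inner_normal_shapeDeriv (q : M) (w : TangentSpace (𝓡 2) q) (u : E3) :
    inner ℝ (S.normal q) (S.shapeDeriv q w u) =
      -inner ℝ (dirDeriv S.normal q w) (S.shapeOperator q u) := by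
  obtain ⟨L, h, hL⟩ := S.exists_hasFDerivAt_shapeCLM q
  obtain ⟨N, hN, hNL⟩ := exists_hasFDerivAt_comp_extChartAt_symm (S.mdifferentiable_normal q)
  have h1 := hN.inner ℝ (h.clm_apply (hasFDerivAt_const u _))
  have h2 : (fun y => inner ℝ ((S.normal ∘ (extChartAt (𝓡 2) q).symm) y)
      ((S.shapeCLM ∘ (extChartAt (𝓡 2) q).symm) y u)) = fun _ => (0 : ℝ) := by
    ext1 y
    simp [inner_normal_shapeOperator]
  rw [h2] at h1
  obtain ⟨w', hw⟩ : ∃ w' : E2, w' = w := ⟨_, rfl⟩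
  have h3 := congrArg (fun L : E2 →L[ℝ] ℝ => L w') (h1.unique (hasFDerivAt_const _ _))
  have h4 : S.shapeDeriv q w = L w' := by rw [hL, hw]; rfl
  have h5 : dirDeriv S.normal q w = N w' := by rw [hNL, hw]; rfl
  rw [h4, h5]
  simp at h3
  linarith

/-- The tangential field obtained by projecting a fixed vector. -/
theorem contMDiff_tangentialPart (u : E3) :
    ContMDiff (𝓡 2) 𝓘(ℝ, E3) ∞ (fun x => tangentialPart (S.normal x) u) := by
  have h : ContDiff ℝ ∞ (fun n : E3 => tangentialPart n u) := by
    exact contDiff_const.sub ((contDiff_id.inner ℝ contDiff_const).smul contDiff_id)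
  exact h.contMDiff.comp S.contMDiff_normal

/-- For u tangent at q, the derivative at q of u − ⟨N, u⟩N is normal, because ⟨N, u⟩ vanishes there.
The projected field is thus covariantly constant at q, and the second term of the covariant
derivative of the shape operator drops out. -/
theorem shapeOperator_dirDeriv_tangentialPart {q : M} {u : E3} (hu : S.IsTangent q u)
    (w : TangentSpace (𝓡 2) q) :
    S.shapeOperator q (dirDeriv (fun x => tangentialPart (S.normal x) u) q w) = 0 := by
  obtain ⟨N, hN, hNL⟩ := exists_hasFDerivAt_comp_extChartAt_symm (S.mdifferentiable_normal q)
  have h1 := (hasFDerivAt_const u _).sub ((hN.inner ℝ (hasFDerivAt_const u _)).smul hN)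
  have hd : MDifferentiableAt (𝓡 2) 𝓘(ℝ, E3) (fun x => tangentialPart (S.normal x) u) q :=
    (contMDiff_tangentialPart u).mdifferentiable (by simp) q
  have h2 := eq_mfderiv_of_hasFDerivAt_comp_extChartAt_symm hd h1
  obtain ⟨w', hw⟩ : ∃ w' : E2, w' = w := ⟨_, rfl⟩
  have hu' : inner ℝ (S.normal q) u = 0 := hu
  have h3 : dirDeriv (fun x => tangentialPart (S.normal x) u) q w =
      -(inner ℝ (N w') u • S.normal q) := by
    have := congrArg (fun L : E2 →L[ℝ] E3 => L w') h2
    simp [hu'] at this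
    rw [this, hw]
    rfl
  rw [h3, map_neg, map_smul, shapeOperator_normal]
  simp

theorem covDerivShape_tangentialPart {q : M} {u : E3} (hu : S.IsTangent q u)
    (w : TangentSpace (𝓡 2) q) :
    S.covDerivShape q w (fun x => tangentialPart (S.normal x) u) =
      tangentialPart (S.normal q) (S.shapeDeriv q w u) := by
  simp only [covDerivShape, covDeriv, shapeOperator_tangentialPart,
    shapeOperator_dirDeriv_tangentialPart hu, sub_zero, dirDeriv_shapeOperator_apply]

theorem IsCurvatureDerivBound.norm_tangentialPart_shapeDeriv_le
    (hK' : S.IsCurvatureDerivBound K') {q : M} {u : E3} (hu : S.IsTangent q u)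
    (w : TangentSpace (𝓡 2) q) :
    ‖tangentialPart (S.normal q) (S.shapeDeriv q w u)‖ ≤ K' * ‖dirDeriv S.toFun q w‖ * ‖u‖ := by
  rcases eq_or_ne u 0 with rfl | h0
  · simp
  have hpos : 0 < ‖u‖ := norm_pos_iff.mpr h0
  rcases eq_or_ne (dirDeriv S.toFun q w) 0 with hw | hw
  · have : w = 0 := S.injective_mfderiv q (hw.trans (map_zero (dirDeriv S.toFun q)).symm)
    simp [this]
  have hwpos : 0 < ‖dirDeriv S.toFun q w‖ := norm_pos_iff.mpr hw
  have hu' : inner ℝ (S.normal q) u = 0 := hu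
  have hu1 : S.IsTangent q (‖u‖⁻¹ • u) := by simp [IsTangent, inner_smul_right, hu']
  -- The bound K' is phrased with globally defined smooth tangential fields; projecting a constant
  -- vector extends any tangent vector at q to such a field.
  have h := hK'.2 ⟨q, ‖dirDeriv S.toFun q w‖⁻¹ • w, _, contMDiff_tangentialPart (‖u‖⁻¹ • u),
    fun x => inner_tangentialPart (S.norm_normal x) _,
    by rw [map_smul, norm_smul, norm_inv, norm_norm, inv_mul_cancel₀ hwpos.ne'],
    by rw [tangentialPart_of_inner_eq_zero hu1, norm_smul, norm_inv, norm_norm,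
      inv_mul_cancel₀ hpos.ne'], rfl⟩
  rw [covDerivShape_tangentialPart hu1, map_smul, map_smul, map_smul, smul_apply, map_smul,
    norm_smul, norm_smul, norm_inv, norm_inv, norm_norm, norm_norm, inv_mul_le_iff₀ hpos,
    inv_mul_le_iff₀ hwpos] at h
  linarith

/-- K' controls only the tangential part of the derivative on tangent vectors. Its normal part on
tangent vectors and its value on N are quadratic in the curvature, by `inner_normal_shapeDeriv` and
`shapeDeriv_normal`; each contributes K². -/
theorem norm_shapeDeriv_le (hK : S.IsCurvatureBound K) (hK' : S.IsCurvatureDerivBound K') (q : M)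
    (w : TangentSpace (𝓡 2) q) :
    ‖S.shapeDeriv q w‖ ≤ (K' + 2 * K ^ 2) * ‖dirDeriv S.toFun q w‖ := by
  have hK0 := hK.nonneg
  have hK0' := hK'.nonneg
  set d := ‖dirDeriv S.toFun q w‖ with hd
  have hd0 : 0 ≤ d := norm_nonneg _
  refine ContinuousLinearMap.opNorm_le_bound _ (by positivity) fun u => ?_
  have hn := S.norm_normal q
  have hN := hK.norm_dirDeriv_normal_le q w
  set τ := tangentialPart (S.normal q) u with hτ
  have hτu : ‖τ‖ ≤ ‖u‖ := norm_tangentialPart_le hn u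
  have hdec : u = τ + inner ℝ (S.normal q) u • S.normal q := by
    rw [hτ, tangentialPart_apply]; abel
  have h1 : ‖S.shapeDeriv q w (S.normal q)‖ ≤ K ^ 2 * d := by
    rw [shapeDeriv_normal, norm_neg]
    refine (hK.norm_shapeOperator_le q _).trans ?_
    nlinarith
  have h2 : |inner ℝ (S.normal q) (S.shapeDeriv q w τ)| ≤ K ^ 2 * d * ‖u‖ := by
    rw [inner_normal_shapeDeriv, abs_neg]
    calc |inner ℝ (dirDeriv S.normal q w) (S.shapeOperator q τ)|
        ≤ ‖dirDeriv S.normal q w‖ * ‖S.shapeOperator q τ‖ := abs_real_inner_le_norm _ _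
      _ ≤ (K * d) * (K * ‖u‖) := by
        gcongr
        exact (hK.norm_shapeOperator_le q τ).trans (by gcongr)
      _ = K ^ 2 * d * ‖u‖ := by ring
  have h3 : ‖tangentialPart (S.normal q) (S.shapeDeriv q w τ)‖ ≤ K' * d * ‖u‖ :=
    (hK'.norm_tangentialPart_shapeDeriv_le (inner_tangentialPart hn u) w).trans (by gcongr)
  have h4 : |inner ℝ (S.normal q) u| ≤ ‖u‖ := by
    simpa [hn] using abs_real_inner_le_norm (S.normal q) u
  have h5 : S.shapeDeriv q w u = tangentialPart (S.normal q) (S.shapeDeriv q w τ) +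
      inner ℝ (S.normal q) (S.shapeDeriv q w τ) • S.normal q +
      inner ℝ (S.normal q) u • S.shapeDeriv q w (S.normal q) := by
    conv_lhs => rw [hdec, map_add, map_smul]
    rw [tangentialPart_apply]
    abel
  rw [h5]
  refine (norm_add₃_le).trans ?_
  rw [norm_smul, norm_smul, hn, Real.norm_eq_abs, Real.norm_eq_abs]
  have h6 : |inner ℝ (S.normal q) u| * ‖S.shapeDeriv q w (S.normal q)‖ ≤ ‖u‖ * (K ^ 2 * d) := by
    gcongr
  linarith

end OrientedImmersedSurface

/-! ## Curves on the surface -/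

/-- A map on `[-1, 1]` whose derivative is bounded by a multiple of an integrable speed varies at
most by that multiple of the total length. -/
theorem norm_sub_le_of_norm_deriv_le_mul {V : Type*} [NormedAddCommGroup V] [NormedSpace ℝ V]
    {G G' : ℝ → V} {v : ℝ → ℝ} {B ε : ℝ} (hB : 0 ≤ B)
    (hG : ∀ t ∈ Set.Icc (-1 : ℝ) 1, HasDerivWithinAt G (G' t) (Set.Icc (-1) 1) t)
    (hv : ContinuousOn v (Set.Icc (-1) 1)) (hv0 : ∀ t, 0 ≤ v t)
    (hle : ∀ t ∈ Set.Icc (-1 : ℝ) 1, ‖G' t‖ ≤ B * v t) (hε : ∫ t in (-1 : ℝ)..1, v t ≤ ε)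
    {s t : ℝ} (hs : s ∈ Set.Icc (-1 : ℝ) 1) (ht : t ∈ Set.Icc (-1 : ℝ) 1) :
    ‖G t - G s‖ ≤ B * ε := by
  wlog hst : s ≤ t generalizing s t
  · rw [norm_sub_rev]
    exact this ht hs (le_of_not_ge hst)
  have hsub : Set.Icc s t ⊆ Set.Icc (-1) 1 := Set.Icc_subset_Icc hs.1 ht.2
  have hd : ∀ x ∈ Set.Ioo s t, HasDerivAt G (G' x) x := fun x hx =>
    (hG x (hsub (Set.Ioo_subset_Icc_self hx))).hasDerivAt
      (Icc_mem_nhds (hs.1.trans_lt hx.1) (hx.2.trans_le ht.2))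
  have hvi : IntervalIntegrable v MeasureTheory.volume (-1) 1 :=
    hv.intervalIntegrable_of_Icc (by norm_num)
  have h1 := norm_sub_le_integral_of_norm_deriv_le_of_le (f := G) (B := fun x => B * v x) hst
    (fun x hx => ((hG x (hsub hx)).continuousWithinAt).mono hsub)
    (fun x hx => (hd x hx).differentiableAt.differentiableWithinAt)
    (Filter.Eventually.of_forall fun x hx => by
      rw [(hd x hx).deriv]
      exact hle x (hsub (Set.Ioo_subset_Icc_self hx)))
    ((hv.mono hsub).intervalIntegrable_of_Icc hst |>.const_mul B)
  refine h1.trans ?_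
  rw [intervalIntegral.integral_const_mul]
  refine mul_le_mul_of_nonneg_left (le_trans ?_ hε) hB
  exact intervalIntegral.integral_mono_interval hs.1 hst ht.2
    (Filter.Eventually.of_forall hv0) hvi

/-- Height estimates for a curve `c` with unit normals `N` along it that satisfy the Weingarten
equation `N' = -A c'` for a field of operators `A`. -/
theorem height_estimates {c c' N : ℝ → E3} {A A' : ℝ → E3 →L[ℝ] E3} {K L ε : ℝ}
    (hK : 0 ≤ K) (hL : 0 ≤ L)
    (hc : ∀ t ∈ Set.Icc (-1 : ℝ) 1, HasDerivWithinAt c (c' t) (Set.Icc (-1) 1) t)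
    (hc' : ContinuousOn c' (Set.Icc (-1) 1))
    (hN : ∀ t ∈ Set.Icc (-1 : ℝ) 1, HasDerivWithinAt N (-A t (c' t)) (Set.Icc (-1) 1) t)
    (hA : ∀ t ∈ Set.Icc (-1 : ℝ) 1, HasDerivWithinAt A (A' t) (Set.Icc (-1) 1) t)
    (hAK : ∀ t ∈ Set.Icc (-1 : ℝ) 1, ‖A t (c' t)‖ ≤ K * ‖c' t‖)
    (hAL : ∀ t ∈ Set.Icc (-1 : ℝ) 1, ‖A' t‖ ≤ L * ‖c' t‖)
    (hNc : ∀ t ∈ Set.Icc (-1 : ℝ) 1, inner ℝ (N t) (c' t) = 0)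
    (hε : ∫ t in (-1 : ℝ)..1, ‖c' t‖ ≤ ε)
    {s t : ℝ} (hs : s ∈ Set.Icc (-1 : ℝ) 1) (ht : t ∈ Set.Icc (-1 : ℝ) 1)
    (hsymm : ∀ u w, inner ℝ (A s u) w = inner ℝ u (A s w)) :
    ‖c t - c s‖ ≤ ε ∧ |inner ℝ (N s) (c t - c s)| ≤ K * ε ^ 2 ∧
      |inner ℝ (N s) (c t - c s) - 1 / 2 * inner ℝ (A s (c t - c s)) (c t - c s)|
        ≤ L * ε ^ 3 := by
  have hε0 : 0 ≤ ε := le_trans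
    (intervalIntegral.integral_nonneg (by norm_num) fun t _ => norm_nonneg (c' t)) hε
  have hvn := hc'.norm
  have hn0 : ∀ t, 0 ≤ ‖c' t‖ := fun t => norm_nonneg _
  -- Three successive integrations from s: A varies by at most Lε, hence N agrees with its linear
  -- model N s − A s (c − c s) up to Lε², hence the height agrees with half the second fundamental
  -- form up to Lε³.
  have hAs : ∀ r ∈ Set.Icc (-1 : ℝ) 1, ‖A r - A s‖ ≤ L * ε := fun r hr =>
    norm_sub_le_of_norm_deriv_le_mul hL hA hvn hn0 hAL hε hs hr
  have hNs : ∀ r ∈ Set.Icc (-1 : ℝ) 1, ‖N r - N s‖ ≤ K * ε := fun r hr =>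
    norm_sub_le_of_norm_deriv_le_mul hK hN hvn hn0 (fun x hx => by rw [norm_neg]; exact hAK x hx)
      hε hs hr
  have hG1 : ∀ r ∈ Set.Icc (-1 : ℝ) 1, ‖N r - N s + A s (c r - c s)‖ ≤ L * ε ^ 2 := by
    intro r hr
    have := norm_sub_le_of_norm_deriv_le_mul (G := fun r => N r - N s + A s (c r - c s))
      (G' := fun r => -A r (c' r) + A s (c' r)) (v := fun t => ‖c' t‖) (B := L * ε) (by positivity)
      (fun x hx => ((hN x hx).sub_const _).add
        ((A s).hasFDerivAt.comp_hasDerivWithinAt x ((hc x hx).sub_const _))) hvn hn0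
      (fun x hx => by
        have : -A x (c' x) + A s (c' x) = -((A x - A s) (c' x)) := by simp; abel
        rw [this, norm_neg]
        exact ((A x - A s).le_opNorm _).trans (by gcongr; exact hAs x hx)) hε hs hr
    simpa [pow_two, mul_assoc] using this
  refine ⟨?_, ?_, ?_⟩
  · simpa using norm_sub_le_of_norm_deriv_le_mul zero_le_one hc hvn hn0 (fun x _ => by simp) hε hs ht
  · have := norm_sub_le_of_norm_deriv_le_mul (G := fun r => inner ℝ (N s) (c r - c s))
      (G' := fun r => inner ℝ (N s) (c' r)) (v := fun t => ‖c' t‖) (B := K * ε) (by positivity)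
      (fun x hx => ((innerSL ℝ (N s)).hasFDerivAt.comp_hasDerivWithinAt x
        ((hc x hx).sub_const _))) hvn hn0
      (fun x hx => by
        -- N x is orthogonal to c' x, so it can be subtracted freely and a factor of order ε is
        -- gained.
        have : inner ℝ (N s) (c' x) = -inner ℝ (N x - N s) (c' x) := by
          rw [inner_sub_left, hNc x hx]; ring
        rw [this, norm_neg]
        exact (norm_inner_le_norm _ _).trans (by gcongr; exact hNs x hx)) hε hs ht
    simpa [pow_two, mul_assoc] using this
  · have := norm_sub_le_of_norm_deriv_le_mul
      (G := fun r => inner ℝ (N s) (c r - c s) - 1 / 2 * inner ℝ (A s (c r - c s)) (c r - c s))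
      (G' := fun r => inner ℝ (N s) (c' r) - 1 / 2 * (inner ℝ (A s (c r - c s)) (c' r) +
        inner ℝ (A s (c' r)) (c r - c s))) (v := fun t => ‖c' t‖) (B := L * ε ^ 2) (by positivity)
      (fun x hx => ((innerSL ℝ (N s)).hasFDerivAt.comp_hasDerivWithinAt x
        ((hc x hx).sub_const _)).sub ((HasDerivWithinAt.inner ℝ
          ((A s).hasFDerivAt.comp_hasDerivWithinAt x ((hc x hx).sub_const _))
          ((hc x hx).sub_const _)).const_mul _)) hvn hn0
      (fun x hx => by
        -- Symmetry of A s merges the two terms of the product rule and cancels the factor 1/2.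
        have : inner ℝ (N s) (c' x) - 1 / 2 * (inner ℝ (A s (c x - c s)) (c' x) +
            inner ℝ (A s (c' x)) (c x - c s)) =
            -inner ℝ (N x - N s + A s (c x - c s)) (c' x) := by
          rw [hsymm (c' x), real_inner_comm _ (c' x), inner_add_left, inner_sub_left, hNc x hx]
          ring
        rw [this, norm_neg]
        exact (norm_inner_le_norm _ _).trans (by gcongr; exact hG1 x hx)) hε hs ht
    simpa [pow_succ, mul_assoc] using this

/-! ### Edges of the net -/

section Nets

variable {M : Type*} [TopologicalSpace M] [ChartedSpace E2 M]

/-- The chain rule along a curve in a surface. -/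
theorem hasDerivWithinAt_comp_curve {V : Type*} [NormedAddCommGroup V] [NormedSpace ℝ V]
    {f : M → V} {γ : ℝ → M} {s : Set ℝ} {t : ℝ} (hf : MDifferentiableAt (𝓡 2) 𝓘(ℝ, V) f (γ t))
    (hγ : MDifferentiableWithinAt 𝓘(ℝ, ℝ) (𝓡 2) γ s t) :
    HasDerivWithinAt (fun r => f (γ r))
      (show V from mfderiv (𝓡 2) 𝓘(ℝ, V) f (γ t)
        (mfderivWithin 𝓘(ℝ, ℝ) (𝓡 2) γ s t (show ℝ from 1))) s t := by
  have h := hf.hasMFDerivAt.comp_hasMFDerivWithinAt t hγ.hasMFDerivWithinAt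
  have h' : HasFDerivWithinAt (fun r => f (γ r)) (show ℝ →L[ℝ] V from
      (mfderiv (𝓡 2) 𝓘(ℝ, V) f (γ t)).comp (mfderivWithin 𝓘(ℝ, ℝ) (𝓡 2) γ s t)) s t :=
    hasMFDerivWithinAt_iff_hasFDerivWithinAt.mp h
  exact h'.hasDerivWithinAt

variable [IsManifold (𝓡 2) ∞ M] [Topology.CWComplex (Set.univ : Set M)]
  {S : OrientedImmersedSurface M} {K K' ε : ℝ}

/-- Size and height of the edge vectors of a discrete net, up to third order. -/
theorem IsCurvatureLineNet.edgeVector_estimates (hnet : IsCurvatureLineNet S)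
    (hK : S.IsCurvatureBound K) (hK' : S.IsCurvatureDerivBound K') {x : Vertex M} {e : Edge M}
    (he : Emanates x e) (hε : edgeLength S e ≤ ε)
    (hsymm : ∀ u w, inner ℝ (S.shapeOperator (vertexPoint x) u) w =
      inner ℝ u (S.shapeOperator (vertexPoint x) w)) :
    ‖edgeVector S x e‖ ≤ ε ∧
      |inner ℝ (S.normal (vertexPoint x)) (edgeVector S x e)| ≤ K * ε ^ 2 ∧
      |inner ℝ (S.normal (vertexPoint x)) (edgeVector S x e) - 1 / 2 *
        inner ℝ (S.shapeOperator (vertexPoint x) (edgeVector S x e)) (edgeVector S x e)| ≤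
        (K' + 2 * K ^ 2) * ε ^ 3 := by
  have hud := uniqueDiffOn_Icc (show (-1 : ℝ) < 1 by norm_num)
  have hγ : ∀ t ∈ Set.Icc (-1 : ℝ) 1, MDifferentiableWithinAt 𝓘(ℝ, ℝ) (𝓡 2) (edgeCurve e)
      (Set.Icc (-1) 1) t := fun t ht => (hnet.edge_smooth e).mdifferentiableOn (by simp) t ht
  have hvel : ∀ t ∈ Set.Icc (-1 : ℝ) 1, edgeVelocity S e t =
      OrientedImmersedSurface.dirDeriv S.toFun (edgeCurve e t)
        (mfderivWithin 𝓘(ℝ, ℝ) (𝓡 2) (edgeCurve e) (Set.Icc (-1) 1) t (show ℝ from 1)) :=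
    fun t ht => (hasDerivWithinAt_comp_curve (S.mdifferentiable_toFun _) (hγ t ht)).derivWithin
      (hud t ht)
  have hcs : ContDiffOn ℝ ∞ (fun r => S.toFun (edgeCurve e r)) (Set.Icc (-1) 1) :=
    contMDiffOn_iff_contDiffOn.mp (S.contMDiff_toFun.comp_contMDiffOn (hnet.edge_smooth e))
  -- The height estimates hold for s and t in either order, so an edge that ends at x needs no
  -- reparametrisation.
  have main : ∀ s ∈ Set.Icc (-1 : ℝ) 1, ∀ t ∈ Set.Icc (-1 : ℝ) 1,
      edgeCurve e s = vertexPoint x → _ := fun s hs t ht hsx =>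
    height_estimates (c := fun r => S.toFun (edgeCurve e r)) (c' := edgeVelocity S e)
      (N := fun r => S.normal (edgeCurve e r)) (A := fun r => S.shapeCLM (edgeCurve e r))
      (A' := fun r => S.shapeDeriv (edgeCurve e r)
        (mfderivWithin 𝓘(ℝ, ℝ) (𝓡 2) (edgeCurve e) (Set.Icc (-1) 1) r (show ℝ from 1)))
      (K := K) (L := K' + 2 * K ^ 2) (ε := ε) hK.nonneg
      (by have := hK'.nonneg; positivity)
      (fun r hr => by
        rw [hvel r hr]
        exact hasDerivWithinAt_comp_curve (S.mdifferentiable_toFun _) (hγ r hr))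
      (hcs.continuousOn_derivWithin hud (by simp))
      (fun r hr => by
        rw [hvel r hr, S.shapeCLM_apply, S.shapeOperator_dirDeriv, neg_neg]
        exact hasDerivWithinAt_comp_curve (S.mdifferentiable_normal _) (hγ r hr))
      (fun r hr => hasDerivWithinAt_comp_curve (S.mdifferentiableAt_shapeCLM _) (hγ r hr))
      (fun r hr => hK.norm_shapeOperator_le _ _)
      (fun r hr => by
        rw [hvel r hr]
        exact OrientedImmersedSurface.norm_shapeDeriv_le hK hK' _ _)
      (fun r hr => by
        rw [hvel r hr]
        exact S.inner_normal _ _) hε hs ht (by simpa [hsx] using hsymm)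
  have h1 : (-1 : ℝ) ∈ Set.Icc (-1 : ℝ) 1 := by simp
  have h2 : (1 : ℝ) ∈ Set.Icc (-1 : ℝ) 1 := by simp
  by_cases h : edgeCurve e (-1) = vertexPoint x
  · have := main (-1) h1 1 h2 h
    simpa [edgeVector, h] using this
  · have h' := he.resolve_left h
    have := main 1 h2 (-1) h1 h'
    simpa [edgeVector, h, h'] using this

end Nets

/-! ## The cross product -/

theorem inner_E3 (u w : E3) : inner ℝ u w = u 0 * w 0 + u 1 * w 1 + u 2 * w 2 := by
  simp [PiLp.inner_apply, Fin.sum_univ_three, mul_comm]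

theorem cross_zero_coord (u w : E3) : cross u w 0 = u 1 * w 2 - u 2 * w 1 := by
  simp [cross, cross_apply]

theorem cross_one_coord (u w : E3) : cross u w 1 = u 2 * w 0 - u 0 * w 2 := by
  simp [cross, cross_apply]

theorem cross_two_coord (u w : E3) : cross u w 2 = u 0 * w 1 - u 1 * w 0 := by
  simp [cross, cross_apply]

theorem inner_cross_cross (a b c d : E3) : inner ℝ (cross a b) (cross c d) =
    inner ℝ a c * inner ℝ b d - inner ℝ a d * inner ℝ b c := by
  simp only [inner_E3, cross_zero_coord, cross_one_coord, cross_two_coord]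
  ring

theorem norm_sq_cross (a b : E3) :
    ‖cross a b‖ ^ 2 = ‖a‖ ^ 2 * ‖b‖ ^ 2 - inner ℝ a b ^ 2 := by
  rw [← real_inner_self_eq_norm_sq, inner_cross_cross, real_inner_self_eq_norm_sq,
    real_inner_self_eq_norm_sq, real_inner_comm b a]
  ring

theorem norm_cross_comm (a b : E3) : ‖cross a b‖ = ‖cross b a‖ := by
  rw [← sq_eq_sq₀ (norm_nonneg _) (norm_nonneg _), norm_sq_cross, norm_sq_cross,
    real_inner_comm a b]
  ring

/-- The face normals are both orthogonal to e. This identity yields the sine of the dihedral angle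
as well as its sign. -/
theorem cross_cross_cross (e f g : E3) :
    cross (cross g e) (cross e f) = inner ℝ g (cross e f) • e := by
  ext i
  fin_cases i <;>
    simp [inner_E3, cross_zero_coord, cross_one_coord, cross_two_coord] <;> ring

/-- Four vectors in space are dependent: (g·(e × f)) n = (n·g) e × f + (n·e) f × g + (n·f) g × e.
Pairing with n separates the heights of the edges from the projected areas. -/
theorem inner_cross_mul_norm_sq (n e f g : E3) : inner ℝ g (cross e f) * ‖n‖ ^ 2 =
    inner ℝ n g * inner ℝ n (cross e f) + inner ℝ n e * inner ℝ n (cross f g) +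
      inner ℝ n f * inner ℝ n (cross g e) := by
  rw [← real_inner_self_eq_norm_sq]
  simp only [inner_E3, cross_zero_coord, cross_one_coord, cross_two_coord]
  ring

/-- Coordinates with respect to the frame `(v 0, v 1, v 0 × v 1)`. -/
theorem Orthonormal.eq_sum_cross {v : Fin 2 → E3} (hv : Orthonormal ℝ v) (u : E3) :
    u = inner ℝ (v 0) u • v 0 + inner ℝ (v 1) u • v 1 +
      inner ℝ (cross (v 0) (v 1)) u • cross (v 0) (v 1) := by
  have h0 : inner ℝ (v 0) (v 0) = 1 := by rw [real_inner_self_eq_norm_sq, hv.1]; norm_num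
  have h1 : inner ℝ (v 1) (v 1) = 1 := by rw [real_inner_self_eq_norm_sq, hv.1]; norm_num
  have h01 : inner ℝ (v 0) (v 1) = 0 := hv.2 (by decide)
  -- The squared norm of the remainder vanishes because the squared triple product is the Gram
  -- determinant.
  have h : ‖u - (inner ℝ (v 0) u • v 0 + inner ℝ (v 1) u • v 1 +
      inner ℝ (cross (v 0) (v 1)) u • cross (v 0) (v 1))‖ ^ 2 = 0 := by
    have hn := inner_cross_cross (v 0) (v 1) (v 0) (v 1)
    rw [h0, h1, real_inner_comm (v 0) (v 1), h01] at hn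
    have hn0 : inner ℝ (v 0) (cross (v 0) (v 1)) = 0 := by
      simp only [inner_E3, cross_zero_coord, cross_one_coord, cross_two_coord]; ring
    have hn1 : inner ℝ (v 1) (cross (v 0) (v 1)) = 0 := by
      simp only [inner_E3, cross_zero_coord, cross_one_coord, cross_two_coord]; ring
    have hgram : inner ℝ (cross (v 0) (v 1)) u ^ 2 =
        inner ℝ u u - inner ℝ (v 0) u ^ 2 - inner ℝ (v 1) u ^ 2 := by
      have hdet : ∀ a b c : E3, inner ℝ (cross a b) c ^ 2 =
          inner ℝ a a * inner ℝ b b * inner ℝ c c + 2 * inner ℝ a b * inner ℝ b c * inner ℝ a c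
            - inner ℝ a a * inner ℝ b c ^ 2 - inner ℝ b b * inner ℝ a c ^ 2
            - inner ℝ c c * inner ℝ a b ^ 2 := by
        intro a b c
        simp only [inner_E3, cross_zero_coord, cross_one_coord, cross_two_coord]
        ring
      rw [hdet, h0, h1, h01]
      ring
    rw [← real_inner_self_eq_norm_sq]
    simp only [inner_sub_left, inner_sub_right, inner_add_left, inner_add_right,
      inner_smul_left, inner_smul_right, h0, h1, h01, hn, hn0, hn1, real_inner_comm (v 0) (v 1),
      real_inner_comm (v 0) (cross (v 0) (v 1)), real_inner_comm (v 1) (cross (v 0) (v 1)),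
      real_inner_comm (v 0) u, real_inner_comm (v 1) u, real_inner_comm (cross (v 0) (v 1)) u,
      conj_trivial]
    linear_combination -hgram
  exact sub_eq_zero.mp (norm_eq_zero.mp (pow_eq_zero_iff two_ne_zero |>.mp h))

theorem Orthonormal.inner_eq_sum_cross {v : Fin 2 → E3} (hv : Orthonormal ℝ v) (u w : E3) :
    inner ℝ u w = inner ℝ (v 0) u * inner ℝ (v 0) w + inner ℝ (v 1) u * inner ℝ (v 1) w +
      inner ℝ (cross (v 0) (v 1)) u * inner ℝ (cross (v 0) (v 1)) w := by
  conv_lhs => rw [hv.eq_sum_cross u]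
  simp only [inner_add_left, inner_smul_left, conj_trivial]

/-! ## Two triangles with a common edge -/

/-- Equidistance from the vertices gives two equations that determine the center. The height h may
be negative, which covers the lower triangle too. -/
theorem circumcenter_eq {a x h : ℝ} (ha : a ≠ 0) (hh : h ≠ 0) :
    circumcenter 0 !₂[a, 0] !₂[x, h] = !₂[a / 2, (x ^ 2 + h ^ 2 - a * x) / (2 * h)] := by
  have hind : AffineIndependent ℝ ![(0 : E2), !₂[a, 0], !₂[x, h]] := by
    rw [affineIndependent_iff_not_collinear_set, collinear_iff_of_mem (p₀ := 0) (by simp)]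
    rintro ⟨w, hw⟩
    obtain ⟨r, hr⟩ := hw !₂[a, 0] (by simp)
    obtain ⟨s, hs⟩ := hw !₂[x, h] (by simp)
    have r0 := congrArg (fun z : E2 => z 0) hr
    have r1 := congrArg (fun z : E2 => z 1) hr
    have s1 := congrArg (fun z : E2 => z 1) hs
    simp at r0 r1 s1
    rcases r1 with rfl | h1
    · simp at r0; exact ha r0
    · rw [h1] at s1; simp at s1; exact hh s1
  rw [circumcenter, dif_pos hind]
  set T : Affine.Simplex ℝ E2 2 := ⟨_, hind⟩ with hT
  have h0 := T.dist_circumcenter_eq_circumradius 0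
  have h1 := T.dist_circumcenter_eq_circumradius 1
  have h2 := T.dist_circumcenter_eq_circumradius 2
  set c := T.circumcenter
  have p0 : T.points 0 = 0 := rfl
  have p1 : T.points 1 = !₂[a, 0] := rfl
  have p2 : T.points 2 = !₂[x, h] := rfl
  rw [← h0, ← sq_eq_sq₀ dist_nonneg dist_nonneg, EuclideanSpace.dist_sq_eq,
    EuclideanSpace.dist_sq_eq, p0] at h1 h2
  rw [p1] at h1
  rw [p2] at h2
  simp [Real.dist_eq, Fin.sum_univ_two, sq_abs] at h1 h2
  have hc0 : c 0 = a / 2 := by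
    have : a * (a - 2 * c 0) = 0 := by linear_combination h1
    have := (mul_eq_zero.mp this).resolve_left ha
    linarith
  have hc1 : c 1 = (x ^ 2 + h ^ 2 - a * x) / (2 * h) := by
    rw [hc0] at h2
    field_simp
    linear_combination -h2
  ext i
  fin_cases i
  · exact hc0
  · exact hc1

/-- The cotangent formula. Both circumcenters lie on the perpendicular bisector of e, at signed
height ½‖e‖ cot of the opposite angle, up to the sign of the side; the factor sgn(⋆e) turns their
distance into the signed difference of heights. -/
theorem circumcentricArea_eq {e f g : E3} (he : e ≠ 0) (hf : cross e f ≠ 0)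
    (hg : cross e g ≠ 0) : circumcentricArea e f g =
      ‖e‖ ^ 2 / 4 * ((‖f‖ ^ 2 - inner ℝ e f) / ‖cross e f‖ +
        (‖g‖ ^ 2 - inner ℝ e g) / ‖cross e g‖) := by
  have hE : ‖e‖ ≠ 0 := norm_ne_zero_iff.mpr he
  have hQ : ‖cross e f‖ ≠ 0 := norm_ne_zero_iff.mpr hf
  have hR : ‖cross e g‖ ≠ 0 := norm_ne_zero_iff.mpr hg
  have hf2 := norm_sq_cross e f
  have hg2 := norm_sq_cross e g
  rw [circumcentricArea, upperCircumcenter, lowerCircumcenter,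
    circumcenter_eq hE (div_ne_zero hQ hE), circumcenter_eq hE (neg_ne_zero.mpr (div_ne_zero hR hE)),
    EuclideanSpace.dist_eq]
  have hyf : ((inner ℝ e f / ‖e‖) ^ 2 + (‖cross e f‖ / ‖e‖) ^ 2 - ‖e‖ * (inner ℝ e f / ‖e‖)) /
      (2 * (‖cross e f‖ / ‖e‖)) = ‖e‖ / 2 * ((‖f‖ ^ 2 - inner ℝ e f) / ‖cross e f‖) := by
    field_simp
    linear_combination hf2
  have hyg : ((inner ℝ e g / ‖e‖) ^ 2 + (-(‖cross e g‖ / ‖e‖)) ^ 2 - ‖e‖ * (inner ℝ e g / ‖e‖)) /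
      (2 * -(‖cross e g‖ / ‖e‖)) = -(‖e‖ / 2 * ((‖g‖ ^ 2 - inner ℝ e g) / ‖cross e g‖)) := by
    field_simp
    linear_combination -hg2
  rw [hyf, hyg]
  simp only [Fin.sum_univ_two, Matrix.cons_val_zero, Matrix.cons_val_one, Real.dist_eq,
    sub_neg_eq_add, sub_self, abs_zero]
  rw [show ∀ y : ℝ, √(0 ^ 2 + |y| ^ 2) = |y| from fun y => by simp [Real.sqrt_sq_eq_abs]]
  have hs : ∀ y : ℝ, 1 / 2 * Real.sign y * ‖e‖ * |y| = 1 / 2 * ‖e‖ * y := fun y => by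
    have : Real.sign y * |y| = y := by
      rcases lt_trichotomy y 0 with h | rfl | h
      · rw [Real.sign_of_neg h, abs_of_neg h]; ring
      · simp
      · rw [Real.sign_of_pos h, abs_of_pos h]; ring
    linear_combination 1 / 2 * ‖e‖ * this
  rw [hs]
  ring

/-- The edge-based curvature agrees to third order with the sine of the dihedral angle, times the
edge length. -/
theorem abs_integratedCurvature_sub_le {e f g : E3} (hf : cross e f ≠ 0) (hg : cross e g ≠ 0)
    (hcos : 0 < inner ℝ (cross e f) (cross g e)) :
    |integratedCurvature e f g -
        ‖e‖ ^ 2 * (inner ℝ g (cross e f) / (‖cross e f‖ * ‖cross e g‖))| ≤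
      ‖e‖ ^ 4 * |inner ℝ g (cross e f) / (‖cross e f‖ * ‖cross e g‖)| ^ 3 := by
  have hQ : 0 < ‖cross e f‖ := norm_pos_iff.mpr hf
  have hR : 0 < ‖cross e g‖ := norm_pos_iff.mpr hg
  have he : e ≠ 0 := by
    rintro rfl
    exact hf (by ext i; fin_cases i <;> simp [cross_zero_coord, cross_one_coord, cross_two_coord])
  have hE : 0 < ‖e‖ := norm_pos_iff.mpr he
  set D := inner ℝ g (cross e f) with hD
  set α := InnerProductGeometry.angle (cross e f) (cross g e) with hα
  have hcosα : 0 < Real.cos α := by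
    rw [hα, InnerProductGeometry.cos_angle]
    have : 0 < ‖cross g e‖ := norm_cross_comm e g ▸ hR
    positivity
  have hα0 : 0 ≤ α := InnerProductGeometry.angle_nonneg _ _
  have hα1 : α ≤ Real.pi := InnerProductGeometry.angle_le_pi _ _
  have hsin : Real.sin α = ‖e‖ * |D| / (‖cross e f‖ * ‖cross e g‖) := by
    have h1 : (Real.sin α * (‖cross e f‖ * ‖cross e g‖)) ^ 2 = (‖e‖ * |D|) ^ 2 := by
      rw [norm_cross_comm e g, hα, InnerProductGeometry.sin_angle_mul_norm_mul_norm,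
        Real.sq_sqrt, mul_pow, sq_abs]
      · have h2 := norm_sq_cross (cross g e) (cross e f)
        rw [cross_cross_cross, norm_smul, mul_pow, Real.norm_eq_abs, sq_abs] at h2
        rw [real_inner_self_eq_norm_sq, real_inner_self_eq_norm_sq, real_inner_comm]
        linear_combination -h2
      · exact sub_nonneg.mpr (by simpa using real_inner_mul_inner_self_le (cross e f) (cross g e))
    have h2 := (sq_eq_sq₀ (mul_nonneg (Real.sin_nonneg_of_nonneg_of_le_pi hα0 hα1)
      (by positivity)) (by positivity)).mp h1
    rw [eq_div_iff (by positivity), h2]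
  set x := Real.sin (α / 2) with hx
  have hx0 : 0 ≤ x := Real.sin_nonneg_of_nonneg_of_le_pi (by linarith) (by linarith)
  set y := Real.cos (α / 2) with hy
  have hy0 : 0 ≤ y := Real.cos_nonneg_of_mem_Icc ⟨by linarith, by linarith⟩
  have hxy : x ^ 2 + y ^ 2 = 1 := Real.sin_sq_add_cos_sq _
  have h2α : α = 2 * (α / 2) := by ring
  have hsin2 : Real.sin α = 2 * x * y := by rw [h2α, Real.sin_two_mul]
  have hcos2 : Real.cos α = 2 * y ^ 2 - 1 := by rw [h2α, Real.cos_two_mul]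
  have hy2 : 1 / 2 < y ^ 2 := by linarith
  have hy1 : y ≤ 1 := by nlinarith
  -- With x = sin(α/2), y = cos(α/2): 0 ≤ 2x(1 − y) ≤ 2x³ ≤ (2xy)³. The last step needs 4y³ ≥ 1,
  -- which follows from y² > 1/2, that is cos α > 0.
  have hbound : |2 * x - Real.sin α| ≤ Real.sin α ^ 3 := by
    rw [hsin2, abs_of_nonneg (by nlinarith)]
    have hy3 : 7 / 10 ≤ y := by nlinarith
    have h1 : 1 - y ≤ x ^ 2 := by nlinarith
    have h2 : 2 * x * (1 - y) ≤ 2 * x * x ^ 2 := by gcongr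
    have h3 : (7 / 10 : ℝ) ^ 3 ≤ y ^ 3 := by gcongr
    have h4 : 0 ≤ x ^ 3 := by positivity
    nlinarith
  have hsign : Real.sign (inner ℝ (cross (cross g e) (cross e f)) e) = Real.sign D := by
    rw [cross_cross_cross, inner_smul_left, real_inner_self_eq_norm_sq, conj_trivial]
    rcases lt_trichotomy D 0 with h | h | h
    · rw [Real.sign_of_neg h, Real.sign_of_neg (mul_neg_of_neg_of_pos h (by positivity))]
    · rw [← hD, h]; simp
    · rw [Real.sign_of_pos h, Real.sign_of_pos (by positivity)]
  have hk : integratedCurvature e f g = Real.sign D * (2 * x) * ‖e‖ := by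
    rw [integratedCurvature, dihedralAngle, hsign, ← hα]
    rcases Real.sign_apply_eq D with h | h | h <;> rw [h]
    · rw [show -1 * α / 2 = -(α / 2) by ring, Real.sin_neg]; ring
    · simp
    · rw [one_mul]; ring
  have hDs : ‖e‖ ^ 2 * (D / (‖cross e f‖ * ‖cross e g‖)) = Real.sign D * Real.sin α * ‖e‖ := by
    have : Real.sign D * |D| = D := by
      rcases lt_trichotomy D 0 with h | h | h
      · rw [Real.sign_of_neg h, abs_of_neg h]; ring
      · simp [h]
      · rw [Real.sign_of_pos h, abs_of_pos h]; ring
    rw [hsin]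
    conv_lhs => rw [← this]
    ring
  have hs1 : |Real.sign D| ≤ 1 := by
    rcases Real.sign_apply_eq D with h | h | h <;> rw [h] <;> simp
  rw [hk, hDs, ← sub_mul, ← mul_sub, abs_mul, abs_mul, abs_of_pos hE]
  calc |Real.sign D| * |2 * x - Real.sin α| * ‖e‖ ≤ 1 * Real.sin α ^ 3 * ‖e‖ := by gcongr
    _ = ‖e‖ ^ 4 * |D / (‖cross e f‖ * ‖cross e g‖)| ^ 3 := by
      rw [hsin, abs_div, abs_of_pos (mul_pos hQ hR)]
      ring

/-- Estimates for one triangle `(0, e, f)` in the coordinates `e = (e₁, e₂, e₃)`,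
`f = (f₁, f₂, f₃)` of a frame whose third vector is the surface normal. -/
theorem triangle_estimates {e₁ e₂ e₃ f₁ f₂ f₃ a E F P Q K ε ρ : ℝ}
    (hE : 0 < E) (hF : 0 < F) (hP : 0 < P) (hQ : 0 < Q) (hK : 0 ≤ K) (hρ : 1 ≤ ρ)
    (hE2 : E ^ 2 = e₁ ^ 2 + e₂ ^ 2 + e₃ ^ 2) (hF2 : F ^ 2 = f₁ ^ 2 + f₂ ^ 2 + f₃ ^ 2)
    (ha : a = e₁ * f₁ + e₂ * f₂ + e₃ * f₃) (hP2 : P ^ 2 = (e₁ * f₂ - e₂ * f₁) ^ 2)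
    (hQ2 : Q ^ 2 = E ^ 2 * F ^ 2 - a ^ 2) (hEε : E ≤ ε) (hεE : ε ≤ ρ * E)
    (hεF : ε ≤ ρ * F) (hEF : E * F ≤ ρ * Q) (he₃ : |e₃| ≤ K * ε ^ 2) (hf₃ : |f₃| ≤ K * ε ^ 2)
    (hs : 16 * K * ρ ^ 2 * ε ≤ 1) :
    Q ^ 2 - P ^ 2 ≤ Q ^ 2 / 64 ∧ P / Q ≤ 1 ∧ 1 - 4 * K ^ 2 * ε ^ 2 * ρ ^ 4 ≤ P / Q ∧
      e₃ ^ 2 / E ^ 2 ≤ 4 * K ^ 2 * ε ^ 2 * ρ ^ 4 ∧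
      E * |(f₃ - a / E ^ 2 * e₃) / Q| ≤ 2 * K * ε * ρ ^ 2 := by
  have hε : 0 < ε := hE.trans_le hEε
  have hρ0 : 0 < ρ := by linarith
  have hρ2 : 1 ≤ ρ ^ 2 := one_le_pow₀ hρ
  -- η bounds the slopes |e₃|/E and |f₃|/F against the tangent plane.
  set η := K * ε * ρ with hη
  have hη0 : 0 ≤ η := by positivity
  have hKε : K * ε ≤ 1 := by
    have : K * ε * 1 ≤ K * ε * ρ ^ 2 := by gcongr
    linarith
  have heη : |e₃| ≤ η * E := he₃.trans (by
    calc K * ε ^ 2 = K * ε * ε := by ring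
      _ ≤ K * ε * (ρ * E) := by gcongr
      _ = η * E := by ring)
  have hfη : |f₃| ≤ η * F := hf₃.trans (by
    calc K * ε ^ 2 = K * ε * ε := by ring
      _ ≤ K * ε * (ρ * F) := by gcongr
      _ = η * F := by ring)
  have he2 : e₃ ^ 2 ≤ η ^ 2 * E ^ 2 := by
    rw [← sq_abs e₃, ← mul_pow]; gcongr
  have hf2 : f₃ ^ 2 ≤ η ^ 2 * F ^ 2 := by
    rw [← sq_abs f₃, ← mul_pow]; gcongr
  have hτ : 4 * η ^ 2 * ρ ^ 2 = 4 * K ^ 2 * ε ^ 2 * ρ ^ 4 := by rw [hη]; ring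
  -- P is the size of the normal component of e × f, so Q² − P² is the squared length of its
  -- tangential part, in which every product contains a height.
  have hdiff : Q ^ 2 - P ^ 2 = (e₂ * f₃ - e₃ * f₂) ^ 2 + (e₃ * f₁ - e₁ * f₃) ^ 2 := by
    rw [hQ2, hP2, hE2, hF2, ha]; ring
  have hEF2 : E ^ 2 * F ^ 2 ≤ ρ ^ 2 * Q ^ 2 := by
    rw [← mul_pow, ← mul_pow]; gcongr
  have ht : Q ^ 2 - P ^ 2 ≤ 4 * η ^ 2 * ρ ^ 2 * Q ^ 2 := by
    have h1 : Q ^ 2 - P ^ 2 ≤ 2 * (f₃ ^ 2 * E ^ 2 + e₃ ^ 2 * F ^ 2) := by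
      rw [hdiff, hE2, hF2]
      linarith only [sq_nonneg (e₂ * f₃ + e₃ * f₂), sq_nonneg (e₃ * f₁ + e₁ * f₃),
        sq_nonneg (e₃ * f₃)]
    have h2 : f₃ ^ 2 * E ^ 2 ≤ η ^ 2 * F ^ 2 * E ^ 2 := by gcongr
    have h3 : e₃ ^ 2 * F ^ 2 ≤ η ^ 2 * E ^ 2 * F ^ 2 := by gcongr
    have h4 : η ^ 2 * (E ^ 2 * F ^ 2) ≤ η ^ 2 * (ρ ^ 2 * Q ^ 2) := by gcongr
    linarith only [h1, h2, h3, h4]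
  have hηρ : 4 * η ^ 2 * ρ ^ 2 ≤ 1 / 64 := by
    have h1 : η * ρ ≤ 1 / 16 := by rw [hη]; linarith only [hs]
    have h2 : (η * ρ) ^ 2 ≤ (1 / 16) ^ 2 := by gcongr
    linarith only [h2]
  have hPQ : P ≤ Q := by
    refine le_of_sq_le_sq ?_ hQ.le
    have : 0 ≤ Q ^ 2 - P ^ 2 := by rw [hdiff]; positivity
    linarith
  have hPQ1 : P / Q ≤ 1 := (div_le_one hQ).mpr hPQ
  have haEF : |a| ≤ E * F := by
    refine abs_le_of_sq_le_sq ?_ (by positivity)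
    have : 0 ≤ Q ^ 2 := by positivity
    rw [mul_pow]; linarith
  refine ⟨?_, hPQ1, ?_, ?_, ?_⟩
  · have : 4 * η ^ 2 * ρ ^ 2 * Q ^ 2 ≤ 1 / 64 * Q ^ 2 := by gcongr
    linarith only [this, ht]
  -- As P ≤ Q, the ratio P/Q is at least its square.
  · rw [← hτ, le_div_iff₀ hQ]
    have h1 : P ^ 2 ≤ P * Q := by rw [pow_two]; gcongr
    have h2 : (1 - 4 * η ^ 2 * ρ ^ 2) * Q * Q ≤ P * Q := by linarith only [h1, ht]
    exact le_of_mul_le_mul_right h2 hQ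
  · rw [← hτ, div_le_iff₀ (by positivity)]
    refine he2.trans ?_
    gcongr
    linarith only [mul_le_mul_of_nonneg_left hρ2 (sq_nonneg η), sq_nonneg η]
  · rw [abs_div, abs_of_pos hQ, mul_div_assoc', div_le_iff₀ hQ]
    have h1 : |f₃ - a / E ^ 2 * e₃| ≤ 2 * η * F := by
      calc |f₃ - a / E ^ 2 * e₃| ≤ |f₃| + |a / E ^ 2 * e₃| := abs_sub _ _
        _ = |f₃| + |a| / E ^ 2 * |e₃| := by
          rw [abs_mul, abs_div, abs_of_pos (pow_pos hE 2)]
        _ ≤ η * F + E * F / E ^ 2 * (η * E) := by gcongr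
        _ = 2 * η * F := by field_simp; ring
    calc E * |f₃ - a / E ^ 2 * e₃| ≤ E * (2 * η * F) := by gcongr
      _ = 2 * η * (E * F) := by ring
      _ ≤ 2 * η * (ρ * Q) := by gcongr
      _ = 2 * K * ε * ρ ^ 2 * Q := by rw [hη]; ring

/-- In the coordinates of `triangle_estimates`, the height of `f` above the edge `e` is governed
by the principal curvature `κ₂` and the circumcenter of the triangle. -/
theorem triangle_height_estimate {e₁ e₂ e₃ f₁ f₂ f₃ a E F Q K L κ₁ κ₂ ε ρ : ℝ}
    (hE : 0 < E) (hF : 0 < F) (hQ : 0 < Q) (hK : 0 ≤ K) (hρ : 1 ≤ ρ)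
    (hE2 : E ^ 2 = e₁ ^ 2 + e₂ ^ 2 + e₃ ^ 2) (hF2 : F ^ 2 = f₁ ^ 2 + f₂ ^ 2 + f₃ ^ 2)
    (ha : a = e₁ * f₁ + e₂ * f₂ + e₃ * f₃)
    (hQ2 : Q ^ 2 = E ^ 2 * F ^ 2 - a ^ 2) (hEε : E ≤ ε) (hFε : F ≤ ε) (hεE : ε ≤ ρ * E)
    (hεF : ε ≤ ρ * F) (hEF : E * F ≤ ρ * Q) (he₃ : |e₃| ≤ K * ε ^ 2) (hf₃ : |f₃| ≤ K * ε ^ 2)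
    (he : |e₃ - 1 / 2 * (κ₁ * e₁ ^ 2 + κ₂ * e₂ ^ 2)| ≤ L * ε ^ 3)
    (hf : |f₃ - 1 / 2 * (κ₁ * f₁ ^ 2 + κ₂ * f₂ ^ 2)| ≤ L * ε ^ 3)
    (hκ₁ : |κ₁| ≤ K) (hκ₂ : |κ₂| ≤ K) (hKε : K * ε ≤ 1) :
    E ^ 2 * |(f₃ - a / E ^ 2 * e₃) / Q - 1 / 2 * κ₂ * ((F ^ 2 - a) / Q)| ≤
      ρ ^ 2 * ((1 + ρ) * (L + K ^ 2) * ε ^ 3 + K ^ 2 * ε ^ 3 +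
        |κ₂ - κ₁| * (|f₁| + |e₂|) * ε) := by
  have hε : 0 < ε := hE.trans_le hEε
  have hρ0 : 0 < ρ := by linarith
  have hL : 0 ≤ L * ε ^ 3 := (abs_nonneg _).trans he
  have haEF : |a| ≤ E * F := by
    refine abs_le_of_sq_le_sq ?_ (by positivity)
    have : 0 ≤ Q ^ 2 := by positivity
    rw [mul_pow]; linarith
  have hK4 : K * (K * ε ^ 2) ^ 2 ≤ K ^ 2 * ε ^ 3 := by
    calc K * (K * ε ^ 2) ^ 2 = K ^ 2 * ε ^ 3 * (K * ε) := by ring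
      _ ≤ K ^ 2 * ε ^ 3 * 1 := by gcongr
      _ = K ^ 2 * ε ^ 3 := mul_one _
  have hsqe : |κ₂ * e₃ ^ 2| ≤ K ^ 2 * ε ^ 3 := by
    refine le_trans ?_ hK4
    rw [abs_mul, abs_pow]
    gcongr
  have hsqf : |κ₂ * f₃ ^ 2| ≤ K ^ 2 * ε ^ 3 := by
    refine le_trans ?_ hK4
    rw [abs_mul, abs_pow]
    gcongr
  have hδ : |κ₂ - κ₁| ≤ 2 * K := (abs_sub _ _).trans (by linarith)
  have he₁ε : |e₁| ≤ ε := le_trans (abs_le_of_sq_le_sq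
      (by linarith only [hE2, sq_nonneg e₂, sq_nonneg e₃]) hE.le) hEε
  have hf₂ε : |f₂| ≤ ε := le_trans (abs_le_of_sq_le_sq
      (by linarith only [hF2, sq_nonneg f₁, sq_nonneg f₃]) hF.le) hFε
  have hf₁ε : |f₁| ≤ ε := le_trans (abs_le_of_sq_le_sq
      (by linarith only [hF2, sq_nonneg f₂, sq_nonneg f₃]) hF.le) hFε
  -- Each product in e·f contains the deviation f₁ or e₂, or else two heights.
  have haε : |κ₂ - κ₁| * |a| ≤ |κ₂ - κ₁| * (|f₁| + |e₂|) * ε + 2 * K ^ 2 * ε ^ 3 := by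
    have h1 : |a| ≤ ε * |f₁| + |e₂| * ε + (K * ε ^ 2) * (K * ε ^ 2) := by
      rw [ha]
      refine (abs_add_three _ _ _).trans ?_
      rw [abs_mul, abs_mul, abs_mul]
      gcongr
    calc |κ₂ - κ₁| * |a| ≤ |κ₂ - κ₁| * (ε * |f₁| + |e₂| * ε + (K * ε ^ 2) * (K * ε ^ 2)) := by
          gcongr
      _ = |κ₂ - κ₁| * (|f₁| + |e₂|) * ε + |κ₂ - κ₁| * (K * ε ^ 2) ^ 2 := by ring
      _ ≤ |κ₂ - κ₁| * (|f₁| + |e₂|) * ε + 2 * K * (K * ε ^ 2) ^ 2 := by gcongr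
      _ ≤ _ := by linarith
  have hratio : |a| / E ^ 2 ≤ ρ := by
    rw [div_le_iff₀ (by positivity)]
    calc |a| ≤ E * F := haEF
      _ ≤ E * (ρ * E) := by gcongr; linarith
      _ = ρ * E ^ 2 := by ring
  -- Replace the heights by their quadratic models and write κ₁f₁² + κ₂f₂² = κ₂(F² − f₃²) − (κ₂ −
  -- κ₁)f₁², likewise for e. The κ₂-terms combine to ½κ₂(F² − a) and cancel.
  have hdec : (f₃ - a / E ^ 2 * e₃) / Q - 1 / 2 * κ₂ * ((F ^ 2 - a) / Q) =
      ((f₃ - 1 / 2 * (κ₁ * f₁ ^ 2 + κ₂ * f₂ ^ 2)) - 1 / 2 * (κ₂ * f₃ ^ 2)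
        - 1 / 2 * ((κ₂ - κ₁) * f₁ ^ 2)
        - a / E ^ 2 * ((e₃ - 1 / 2 * (κ₁ * e₁ ^ 2 + κ₂ * e₂ ^ 2)) - 1 / 2 * (κ₂ * e₃ ^ 2))
        + 1 / 2 * ((κ₂ - κ₁) * a * (e₁ ^ 2 / E ^ 2))) / Q := by
    rw [hF2]
    field_simp
    rw [hE2]
    ring
  have hbr : ∀ x y : ℝ, |x| ≤ L * ε ^ 3 → |y| ≤ K ^ 2 * ε ^ 3 →
      |x - 1 / 2 * y| ≤ (L + K ^ 2) * ε ^ 3 - K ^ 2 * ε ^ 3 / 2 := by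
    intro x y hx hy
    refine (abs_sub _ _).trans ?_
    rw [abs_mul, abs_of_pos (by norm_num : (0 : ℝ) < 1 / 2)]
    linarith
  have hq : E ^ 2 / Q ≤ ρ ^ 2 := by
    rw [div_le_iff₀ hQ]
    calc E ^ 2 = E * E := by ring
      _ ≤ E * (ρ * F) := by gcongr; linarith
      _ = ρ * (E * F) := by ring
      _ ≤ ρ * (ρ * Q) := by gcongr
      _ = ρ ^ 2 * Q := by ring
  rw [hdec, abs_div, abs_of_pos hQ, mul_div_assoc', mul_div_right_comm]
  refine mul_le_mul hq ?_ (abs_nonneg _) (by positivity)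
  have b1 := hbr _ _ hf hsqf
  have b2 := hbr _ _ he hsqe
  have b3 : |1 / 2 * ((κ₂ - κ₁) * f₁ ^ 2)| ≤ 1 / 2 * (|κ₂ - κ₁| * |f₁| * ε) := by
    rw [abs_mul, abs_mul, abs_pow, abs_of_pos (by norm_num : (0 : ℝ) < 1 / 2), pow_two,
      mul_assoc |κ₂ - κ₁|]
    gcongr
  have b4 : |a / E ^ 2 * ((e₃ - 1 / 2 * (κ₁ * e₁ ^ 2 + κ₂ * e₂ ^ 2)) - 1 / 2 * (κ₂ * e₃ ^ 2))| ≤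
      ρ * ((L + K ^ 2) * ε ^ 3) := by
    rw [abs_mul, abs_div, abs_of_pos (pow_pos hE 2)]
    refine mul_le_mul hratio (b2.trans ?_) (abs_nonneg _) hρ0.le
    have : 0 ≤ K ^ 2 * ε ^ 3 := by positivity
    linarith
  have b5 : |1 / 2 * ((κ₂ - κ₁) * a * (e₁ ^ 2 / E ^ 2))| ≤
      1 / 2 * (|κ₂ - κ₁| * (|f₁| + |e₂|) * ε + 2 * K ^ 2 * ε ^ 3) := by
    have h1 : e₁ ^ 2 / E ^ 2 ≤ 1 := by
      rw [div_le_one (by positivity)]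
      linarith only [hE2, sq_nonneg e₂, sq_nonneg e₃]
    rw [abs_mul, abs_mul, abs_mul, abs_of_pos (by norm_num : (0 : ℝ) < 1 / 2),
      abs_of_nonneg (by positivity : 0 ≤ e₁ ^ 2 / E ^ 2)]
    calc 1 / 2 * (|κ₂ - κ₁| * |a| * (e₁ ^ 2 / E ^ 2)) ≤ 1 / 2 * (|κ₂ - κ₁| * |a| * 1) := by gcongr
      _ ≤ _ := by linarith
  have b6 : 0 ≤ |κ₂ - κ₁| * |e₂| * ε := by positivity
  have b7 : 0 ≤ K ^ 2 * ε ^ 3 := by positivity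
  generalize a / E ^ 2 * ((e₃ - 1 / 2 * (κ₁ * e₁ ^ 2 + κ₂ * e₂ ^ 2)) - 1 / 2 * (κ₂ * e₃ ^ 2)) = y4
    at b4 ⊢
  generalize 1 / 2 * ((κ₂ - κ₁) * a * (e₁ ^ 2 / E ^ 2)) = y5 at b5 ⊢
  generalize 1 / 2 * ((κ₂ - κ₁) * f₁ ^ 2) = y3 at b3 ⊢
  generalize (f₃ - 1 / 2 * (κ₁ * f₁ ^ 2 + κ₂ * f₂ ^ 2)) - 1 / 2 * (κ₂ * f₃ ^ 2) = y1 at b1 ⊢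
  have htri : |y1 - y3 - y4 + y5| ≤ |y1| + |y3| + |y4| + |y5| :=
    (abs_add_le _ _).trans (add_le_add_left ((abs_sub _ _).trans
      (add_le_add_left (abs_sub _ _) _)) _)
  linarith only [htri, b1, b3, b4, b5, b6, b7]

/-- Perturbing the weights of a sum of two small terms by a relative error `τ`. -/
theorem abs_sub_add_le_of_mul_eq {E X μ Z₁ Z₂ l₁ l₂ τ b : ℝ} (hE : 0 ≤ E)
    (hX : X * μ = Z₁ * l₂ + Z₂ * l₁) (hτ : τ ≤ 1 / 64) (hμ : 1 - τ ≤ μ) (hμ' : μ ≤ 1)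
    (hl₁ : 1 - τ ≤ l₁) (hl₁' : l₁ ≤ 1) (hl₂ : 1 - τ ≤ l₂) (hl₂' : l₂ ≤ 1)
    (hZ₁ : E * |Z₁| ≤ b) (hZ₂ : E * |Z₂| ≤ b) :
    E * |X - (Z₁ + Z₂)| ≤ 4 * b * τ ∧ E * |X| ≤ 4 * b := by
  have hτ0 : 0 ≤ τ := by linarith
  have hb : 0 ≤ b := le_trans (by positivity) hZ₁
  have h1 : |l₁ - μ| ≤ τ := abs_le.mpr ⟨by linarith, by linarith⟩
  have h2 : |l₂ - μ| ≤ τ := abs_le.mpr ⟨by linarith, by linarith⟩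
  have hμ2 : 1 / 2 ≤ μ := by linarith
  have key : E * |X - (Z₁ + Z₂)| * (1 / 2) ≤ 2 * b * τ := by
    calc E * |X - (Z₁ + Z₂)| * (1 / 2) ≤ E * |X - (Z₁ + Z₂)| * μ := by gcongr
      -- Only the differences between the weights and μ survive; both are at most τ.
      _ = E * |Z₁ * (l₂ - μ) + Z₂ * (l₁ - μ)| := by
        rw [mul_assoc, ← abs_of_pos (by linarith : 0 < μ), ← abs_mul,
          abs_of_pos (by linarith : 0 < μ)]
        congr 2
        linear_combination hX
      _ ≤ E * (|Z₁| * τ + |Z₂| * τ) := by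
        gcongr
        refine (abs_add_le _ _).trans ?_
        rw [abs_mul, abs_mul]
        gcongr
      _ = E * |Z₁| * τ + E * |Z₂| * τ := by ring
      _ ≤ b * τ + b * τ := by gcongr
      _ = 2 * b * τ := by ring
  refine ⟨by linarith, ?_⟩
  have h3 : E * |X| ≤ E * |X - (Z₁ + Z₂)| + E * |Z₁| + E * |Z₂| := by
    rw [← mul_add, ← mul_add]
    gcongr
    calc |X| = |X - (Z₁ + Z₂) + Z₁ + Z₂| := by congr 1; ring
      _ ≤ _ := abs_add_three _ _ _
  have h4 : b * τ ≤ b * (1 / 64) := by gcongr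
  linarith

/-- The discrete integrated curvature of the common edge of two triangles, compared with
the circumcentric area. -/
theorem abs_integratedCurvature_sub_circumcentricArea_le {v : Fin 2 → E3} {n e f g : E3}
    {K L κ₁ κ₂ ε ρ : ℝ} (hv : Orthonormal ℝ v) (hn : cross (v 0) (v 1) = n)
    (hK : 0 ≤ K) (hρ : 1 ≤ ρ) (hκ₁ : |κ₁| ≤ K) (hκ₂ : |κ₂| ≤ K) (hs : 16 * K * ρ ^ 2 * ε ≤ 1)
    (hlen : ∀ u ∈ ({e, f, g} : Set E3), ‖u‖ ≤ ε ∧ ε ≤ ρ * ‖u‖ ∧ |inner ℝ n u| ≤ K * ε ^ 2 ∧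
      |inner ℝ n u - 1 / 2 * (κ₁ * inner ℝ (v 0) u ^ 2 + κ₂ * inner ℝ (v 1) u ^ 2)| ≤ L * ε ^ 3)
    (hf : ‖e‖ * ‖f‖ ≤ ρ * ‖cross e f‖) (hg : ‖e‖ * ‖g‖ ≤ ρ * ‖cross e g‖)
    (hnf : 0 < inner ℝ n (cross e f)) (hng : inner ℝ n (cross e g) < 0) :
    |integratedCurvature e f g - 2 * circumcentricArea e f g * κ₂| ≤
      (2 * ρ ^ 2 * ((1 + ρ) * (L + K ^ 2) + K ^ 2 + 1) + 34 * K ^ 2 * ρ ^ 4) *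
        (|κ₂ - κ₁| * (|inner ℝ (v 1) e| + |inner ℝ (v 0) f| + |inner ℝ (v 0) g|) * ε
          + ε ^ 3) := by
  have hee := hlen e (by simp)
  have hff := hlen f (by simp)
  have hgg := hlen g (by simp)
  have hin := hv.inner_eq_sum_cross
  rw [hn] at hin
  have hcr : ∀ a b, inner ℝ n (cross a b) =
      inner ℝ (v 0) a * inner ℝ (v 1) b - inner ℝ (v 0) b * inner ℝ (v 1) a := fun a b => by
    rw [← hn, inner_cross_cross]
  have hcf0 : cross e f ≠ 0 := fun h => by simp [h] at hnf
  have hcg0 : cross e g ≠ 0 := fun h => by simp [h] at hng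
  have hQ : 0 < ‖cross e f‖ := norm_pos_iff.mpr hcf0
  have hR : 0 < ‖cross e g‖ := norm_pos_iff.mpr hcg0
  have hQ2 := norm_sq_cross e f
  have hR2 := norm_sq_cross e g
  have hzero : ∀ w : E3, cross 0 w = 0 ∧ cross w 0 = 0 := fun w => by
    constructor <;> ext i <;> fin_cases i <;>
      simp [cross_zero_coord, cross_one_coord, cross_two_coord]
  have he0 : e ≠ 0 := by rintro rfl; exact hcf0 (hzero f).1
  have hf0 : f ≠ 0 := by rintro rfl; exact hcf0 (hzero e).2
  have hg0 : g ≠ 0 := by rintro rfl; exact hcg0 (hzero e).2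
  have hE : 0 < ‖e‖ := norm_pos_iff.mpr he0
  have hε : 0 < ε := hE.trans_le hee.1
  have hns : ∀ u, ‖u‖ ^ 2 = inner ℝ (v 0) u ^ 2 + inner ℝ (v 1) u ^ 2 + inner ℝ n u ^ 2 :=
    fun u => by rw [← real_inner_self_eq_norm_sq, hin]; ring
  set Pf := inner ℝ n (cross e f) with hPf
  obtain ⟨Pg, hPg⟩ : ∃ Pg, Pg = -inner ℝ n (cross e g) := ⟨_, rfl⟩
  have hPg0 : 0 < Pg := by rw [hPg]; linarith
  obtain ⟨tf, hPQ, hPQ', tE, tZ⟩ := triangle_estimates hE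
    (norm_pos_iff.mpr hf0) hnf hQ hK hρ (hns e) (hns f) (hin e f)
    (by rw [hPf, hcr]; ring) hQ2 hee.1 hee.2.1 hff.2.1 hf
    hee.2.2.1 hff.2.2.1 hs
  obtain ⟨tg, hPR, hPR', -, uZ⟩ := triangle_estimates hE
    (norm_pos_iff.mpr hg0) hPg0 hR hK hρ (hns e) (hns g) (hin e g)
    (by rw [hPg, hcr]; ring) hR2 hee.1 hee.2.1 hgg.2.1 hg
    hee.2.2.1 hgg.2.2.1 hs
  have hKε : K * ε ≤ 1 := by
    have : K * ε * 1 ≤ K * ε * ρ ^ 2 := by gcongr; exact one_le_pow₀ hρ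
    linarith
  have tY := triangle_height_estimate hE (norm_pos_iff.mpr hf0) hQ hK hρ (hns e) (hns f) (hin e f)
    hQ2 hee.1 hff.1 hee.2.1 hff.2.1 hf hee.2.2.1 hff.2.2.1 hee.2.2.2 hff.2.2.2 hκ₁ hκ₂ hKε
  have uY := triangle_height_estimate hE (norm_pos_iff.mpr hg0) hR hK hρ (hns e) (hns g) (hin e g)
    hR2 hee.1 hgg.1 hee.2.1 hgg.2.1 hg hee.2.2.1 hgg.2.2.1 hee.2.2.2 hgg.2.2.2 hκ₁ hκ₂ hKε
  have hτ : 4 * K ^ 2 * ε ^ 2 * ρ ^ 4 ≤ 1 / 64 := by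
    have h1 : (K * ε * ρ ^ 2) ^ 2 ≤ (1 / 16) ^ 2 := by
      gcongr; linarith only [hs]
    linarith only [h1]
  have hcge : inner ℝ n (cross g e) = Pg := by rw [hPg, hcr, hcr]; ring
  have hn1 : ‖n‖ ^ 2 = 1 := by
    rw [← hn, norm_sq_cross, hv.1, hv.1, hv.2 (by decide : (0 : Fin 2) ≠ 1)]
    norm_num
  -- Both face normals have positive normal components, and their tangential parts are too small to
  -- outweigh the product of these, by Cauchy–Schwarz.
  have hcos : 0 < inner ℝ (cross e f) (cross g e) := by
    have h1 := hns (cross e f)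
    have h2 := hns (cross g e)
    rw [norm_cross_comm g e, hcge] at h2
    rw [hin, hcge]
    rw [← hPf] at h1 ⊢
    generalize inner ℝ (v 0) (cross e f) = A₀ at h1 ⊢
    generalize inner ℝ (v 1) (cross e f) = A₁ at h1 ⊢
    generalize inner ℝ (v 0) (cross g e) = B₀ at h2 ⊢
    generalize inner ℝ (v 1) (cross g e) = B₁ at h2 ⊢
    have h3 : A₀ ^ 2 + A₁ ^ 2 ≤ 1 / 2 * Pf ^ 2 := by
      linarith only [h1, tf, sq_nonneg Pf]
    have h4 : B₀ ^ 2 + B₁ ^ 2 ≤ 1 / 2 * Pg ^ 2 := by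
      linarith only [h2, tg, sq_nonneg Pg]
    have h5 : |A₀ * B₀ + A₁ * B₁| < Pf * Pg := by
      refine abs_lt_of_sq_lt_sq ?_ (by positivity)
      calc (A₀ * B₀ + A₁ * B₁) ^ 2 ≤ (A₀ ^ 2 + A₁ ^ 2) * (B₀ ^ 2 + B₁ ^ 2) := by
            linarith only [sq_nonneg (A₀ * B₁ - A₁ * B₀)]
        _ ≤ (1 / 2 * Pf ^ 2) * (1 / 2 * Pg ^ 2) := by gcongr
        _ < (Pf * Pg) ^ 2 := by
          have : 0 < (Pf * Pg) ^ 2 := by positivity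
          linarith only [this]
    linarith only [(abs_lt.mp h5).1]
  have hD := inner_cross_mul_norm_sq n e f g
  rw [hn1, mul_one, hcge, ← hPf] at hD
  -- The expansion of the triple product along n, regrouped so that each triangle contributes its
  -- own Z. The weights and the factor 1 − e₃²/‖e‖² are 1 up to 4K²ε²ρ⁴.
  have hXμ : inner ℝ g (cross e f) / (‖cross e f‖ * ‖cross e g‖) *
      (1 - inner ℝ n e ^ 2 / ‖e‖ ^ 2) =
      (inner ℝ n f - inner ℝ e f / ‖e‖ ^ 2 * inner ℝ n e) / ‖cross e f‖ * (Pg / ‖cross e g‖) +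
      (inner ℝ n g - inner ℝ e g / ‖e‖ ^ 2 * inner ℝ n e) / ‖cross e g‖ * (Pf / ‖cross e f‖) := by
    have h1 : inner ℝ g (cross e f) * (‖e‖ ^ 2 - inner ℝ n e ^ 2) =
        (inner ℝ n f * ‖e‖ ^ 2 - inner ℝ e f * inner ℝ n e) * Pg +
        (inner ℝ n g * ‖e‖ ^ 2 - inner ℝ e g * inner ℝ n e) * Pf := by
      rw [hD, hns e, hin e f, hin e g, hPg, hPf, hcr, hcr, hcr]
      ring
    field_simp
    linear_combination h1
  obtain ⟨c1, c2⟩ := abs_sub_add_le_of_mul_eq hE.le hXμ hτ (by linarith only [tE])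
    (by linarith only [div_nonneg (sq_nonneg (inner ℝ n e)) (sq_nonneg ‖e‖)])
    hPQ' hPQ hPR' hPR tZ uZ
  have ang := abs_integratedCurvature_sub_le hcf0 hcg0 hcos
  rw [circumcentricArea_eq he0 hcf0 hcg0]
  generalize inner ℝ g (cross e f) / (‖cross e f‖ * ‖cross e g‖) = X at c1 c2 ang
  generalize (inner ℝ n f - inner ℝ e f / ‖e‖ ^ 2 * inner ℝ n e) / ‖cross e f‖ = Zf at c1 tY
  generalize (inner ℝ n g - inner ℝ e g / ‖e‖ ^ 2 * inner ℝ n e) / ‖cross e g‖ = Zg at c1 uY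
  generalize (‖f‖ ^ 2 - inner ℝ e f) / ‖cross e f‖ = Wf at tY ⊢
  generalize (‖g‖ ^ 2 - inner ℝ e g) / ‖cross e g‖ = Wg at uY ⊢
  -- The errors below are of order ε⁴ with K³ρ⁶; the sampling condition absorbs one factor Kρ²ε.
  -- They contribute 32 and 2, whence the 34 in the constant.
  have hpow : ∀ m : ℕ, ε ^ 3 * (K ^ 2 * ρ ^ m) * (16 * K * ρ ^ 2 * ε) ≤ ε ^ 3 * (K ^ 2 * ρ ^ m) :=
    fun m => mul_le_of_le_one_right (by positivity) hs
  have hang : ‖e‖ ^ 4 * |X| ^ 3 ≤ 32 * (ε ^ 3 * (K ^ 2 * ρ ^ 4)) := by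
    calc ‖e‖ ^ 4 * |X| ^ 3 = ‖e‖ * (‖e‖ * |X|) ^ 3 := by ring
      _ ≤ ε * (4 * (2 * K * ε * ρ ^ 2)) ^ 3 := by gcongr; exact hee.1
      _ = 32 * (ε ^ 3 * (K ^ 2 * ρ ^ 4) * (16 * K * ρ ^ 2 * ε)) := by ring
      _ ≤ _ := mul_le_mul_of_nonneg_left (hpow 4) (by norm_num)
  have hc1 : ‖e‖ ^ 2 * |X - (Zf + Zg)| ≤ 2 * (ε ^ 3 * (K ^ 2 * ρ ^ 4)) := by
    calc ‖e‖ ^ 2 * |X - (Zf + Zg)| = ‖e‖ * (‖e‖ * |X - (Zf + Zg)|) := by ring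
      _ ≤ ε * (4 * (2 * K * ε * ρ ^ 2) * (4 * K ^ 2 * ε ^ 2 * ρ ^ 4)) := by gcongr; exact hee.1
      _ = 2 * (ε ^ 3 * (K ^ 2 * ρ ^ 4) * (16 * K * ρ ^ 2 * ε)) := by ring
      _ ≤ _ := mul_le_mul_of_nonneg_left (hpow 4) (by norm_num)
  set k := integratedCurvature e f g
  have htri : |k - 2 * (‖e‖ ^ 2 / 4 * (Wf + Wg)) * κ₂| ≤ |k - ‖e‖ ^ 2 * X| +
      ‖e‖ ^ 2 * |X - (Zf + Zg)| + ‖e‖ ^ 2 * |Zf - 1 / 2 * κ₂ * Wf| +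
      ‖e‖ ^ 2 * |Zg - 1 / 2 * κ₂ * Wg| := by
    have h0 : |‖e‖ ^ 2| = ‖e‖ ^ 2 := abs_of_nonneg (by positivity)
    nth_rewrite 3 [← h0]
    nth_rewrite 4 [← h0]
    nth_rewrite 5 [← h0]
    rw [← abs_mul, ← abs_mul, ← abs_mul]
    refine le_trans (le_of_eq ?_) ((abs_add_le _ _).trans
      (add_le_add_left (abs_add_three _ _ _) _))
    congr 1
    ring
  have hd0 : 0 ≤ |κ₂ - κ₁| * |inner ℝ (v 1) e| * ε := by positivity
  have hdf : 0 ≤ |κ₂ - κ₁| * |inner ℝ (v 0) f| * ε := by positivity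
  have hdg : 0 ≤ |κ₂ - κ₁| * |inner ℝ (v 0) g| * ε := by positivity
  have hL : 0 ≤ L * ε ^ 3 := (abs_nonneg _).trans hee.2.2.2
  have hL' : 0 ≤ L := nonneg_of_mul_nonneg_left hL (by positivity)
  have hsum : |k - 2 * (‖e‖ ^ 2 / 4 * (Wf + Wg)) * κ₂| ≤
      (2 * ρ ^ 2 * ((1 + ρ) * (L + K ^ 2) + K ^ 2) + 34 * K ^ 2 * ρ ^ 4) * ε ^ 3 + 2 * ρ ^ 2 *
        (|κ₂ - κ₁| * (|inner ℝ (v 1) e| + |inner ℝ (v 0) f| + |inner ℝ (v 0) g|) * ε) := by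
    have h1 := mul_nonneg (sq_nonneg ρ) hdf
    have h2 := mul_nonneg (sq_nonneg ρ) hdg
    linarith only [htri, ang, hang, hc1, tY, uY, h1, h2]
  -- The two coefficients are added into one constant; the summand 1 in its bracket accounts for the
  -- coefficient 2ρ² of the deviation term.
  refine hsum.trans ?_
  set d := |κ₂ - κ₁| * (|inner ℝ (v 1) e| + |inner ℝ (v 0) f| + |inner ℝ (v 0) g|) * ε
  have hd : 0 ≤ d := by positivity
  have hA : 0 ≤ 2 * ρ ^ 2 * ((1 + ρ) * (L + K ^ 2) + K ^ 2) + 34 * K ^ 2 * ρ ^ 4 := by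
    have : 0 ≤ ρ := by linarith only [hρ]
    positivity
  have hAd := mul_nonneg hA hd
  have hρε : 0 ≤ 2 * ρ ^ 2 * ε ^ 3 := by positivity
  linarith only [hAd, hρε]

/-! ### The shape operator in a Darboux frame -/

section Darboux

variable {M : Type*} [TopologicalSpace M] [ChartedSpace E2 M] [IsManifold (𝓡 2) ∞ M]
  {S : OrientedImmersedSurface M} {q : M} {v : Fin 2 → E3} {κ : Fin 2 → ℝ}

namespace OrientedImmersedSurface.IsDarbouxFrame

theorem shapeOperator_eq (h : S.IsDarbouxFrame q v κ) (u : E3) :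
    S.shapeOperator q u =
      (κ 0 * inner ℝ (v 0) u) • v 0 + (κ 1 * inner ℝ (v 1) u) • v 1 := by
  conv_lhs => rw [h.orthonormal.eq_sum_cross u]
  rw [h.cross_eq, map_add, map_add, map_smul, map_smul, map_smul, h.principal, h.principal,
    S.shapeOperator_normal, smul_zero, add_zero, smul_smul, smul_smul, mul_comm (κ 0),
    mul_comm (κ 1)]

theorem inner_shapeOperator (h : S.IsDarbouxFrame q v κ) (u w : E3) :
    inner ℝ (S.shapeOperator q u) w =
      κ 0 * inner ℝ (v 0) u * inner ℝ (v 0) w + κ 1 * inner ℝ (v 1) u * inner ℝ (v 1) w := by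
  rw [h.shapeOperator_eq, inner_add_left, inner_smul_left, inner_smul_left, conj_trivial,
    conj_trivial]

/-- An orthonormal frame of principal directions diagonalises the operator. This supplies the
symmetry that the height estimates need, which is only at the vertex. -/
theorem inner_shapeOperator_comm (h : S.IsDarbouxFrame q v κ) (u w : E3) :
    inner ℝ (S.shapeOperator q u) w = inner ℝ u (S.shapeOperator q w) := by
  rw [real_inner_comm (S.shapeOperator q w) u, h.inner_shapeOperator, h.inner_shapeOperator]
  ring

theorem abs_principalCurvature_le (h : S.IsDarbouxFrame q v κ) {K : ℝ}
    (hK : S.IsCurvatureBound K) (i : Fin 2) : |κ i| ≤ K := by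
  have h1 := hK.norm_shapeOperator_le q (v i)
  rwa [h.principal, norm_smul, h.orthonormal.1, mul_one, mul_one] at h1

end OrientedImmersedSurface.IsDarbouxFrame

end Darboux

/-! ### Consequences of shape regularity -/

section ShapeRegularity

variable {M : Type*} [TopologicalSpace M] [ChartedSpace E2 M] [IsManifold (𝓡 2) ∞ M]
  [Topology.CWComplex (Set.univ : Set M)] {S : OrientedImmersedSurface M} {x : Vertex M}
  {e f : Edge M} {ε ρ : ℝ}

theorem SpanStarTriangle.symm {M : Type*} [TopologicalSpace M]
    [Topology.CWComplex (Set.univ : Set M)] {x : Vertex M} {e f : Edge M}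
    (h : SpanStarTriangle x e f) : SpanStarTriangle x f e := by
  obtain ⟨h1, h2, h3, c, h4, h5⟩ := h
  exact ⟨h1.symm, h3, h2, c, h5, h4⟩

theorem IsShapeRegularity.le_mul_norm (h : IsShapeRegularity S x ε ρ)
    (hef : SpanStarTriangle x e f) : ε ≤ ρ * ‖edgeVector S x e‖ := by
  have h1 := (h.1.2 e f hef).1
  rwa [div_le_iff₀' (by linarith [h.1.1])] at h1

theorem IsShapeRegularity.norm_mul_norm_le (h : IsShapeRegularity S x ε ρ)
    (hef : SpanStarTriangle x e f) : ‖edgeVector S x e‖ * ‖edgeVector S x f‖ ≤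
      ρ * ‖cross (edgeVector S x e) (edgeVector S x f)‖ := by
  obtain ⟨-, h1, h2⟩ := h.1.2 e f hef
  rwa [div_le_iff₀ h1] at h2

end ShapeRegularity

/-! ### The curvature estimate for nets -/

theorem mainTheorem4 :
    ∃ C : ℝ → ℝ → ℝ → ℝ,
      ∀ (M : Type*) [TopologicalSpace M] [T2Space M] [CompactSpace M] [ChartedSpace E2 M]
        [IsManifold (𝓡 2) ∞ M] [Topology.CWComplex (Set.univ : Set M)]
        (S : OrientedImmersedSurface M) (_ : IsCurvatureLineNet S)
        (K K' : ℝ) (_ : S.IsCurvatureBound K) (_ : S.IsCurvatureDerivBound K')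
        (p : Vertex M)
        (ε ρ : ℝ) (_ : IsMaxEdgeLength S p ε) (_ : IsShapeRegularity S p ε ρ)
        (_ : 16 * K * ρ ^ 2 * ε ≤ 1)
        (v : Fin 2 → E3) (κ : Fin 2 → ℝ) (_ : S.IsDarbouxFrame (vertexPoint p) v κ)
        (a : Edge M → Fin 2)
        (_ : IsAssociation S p v a)
        (e f g : Edge M)
        (_ : SpanStarTriangle p e f) (_ : SpanStarTriangle p e g)
        (_ : 0 < inner ℝ (S.normal (vertexPoint p)) (cross (edgeVector S p e) (edgeVector S p f)))
        (_ : inner ℝ (S.normal (vertexPoint p)) (cross (edgeVector S p e) (edgeVector S p g)) < 0)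
        (_ : a e = 0) (_ : a f = 1) (_ : a g = 1),
        |integratedCurvature (edgeVector S p e) (edgeVector S p f) (edgeVector S p g) -
            2 * circumcentricArea (edgeVector S p e) (edgeVector S p f) (edgeVector S p g) * κ 1| ≤
          C K K' ρ *
            (|(κ 1 - κ 0) * (tangentialDeviation v (a e) (edgeVector S p e) +
                tangentialDeviation v (a f) (edgeVector S p f) +
                tangentialDeviation v (a g) (edgeVector S p g))| * ε + ε ^ 3) := by
  -- The constant of the two-triangle estimate with L = K' + 2K², the bound on the derivative of the
  -- shape operator.
  refine ⟨fun K K' ρ => 2 * ρ ^ 2 * ((1 + ρ) * (K' + 2 * K ^ 2 + K ^ 2) + K ^ 2 + 1) +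
    34 * K ^ 2 * ρ ^ 4, ?_⟩
  intro M _ _ _ _ _ _ S hnet K K' hK hK' p ε ρ hε hρ hs v κ hv a _ e f g hef heg hnf hng hae haf hag
  have hest : ∀ c, Emanates p c → ‖edgeVector S p c‖ ≤ ε ∧ _ := fun c hc =>
    hnet.edgeVector_estimates hK hK' hc (hε.2 ⟨c, hc, rfl⟩) hv.inner_shapeOperator_comm
  have hlen : ∀ c d, SpanStarTriangle p c d →
      ‖edgeVector S p c‖ ≤ ε ∧ ε ≤ ρ * ‖edgeVector S p c‖ ∧
      |inner ℝ (S.normal (vertexPoint p)) (edgeVector S p c)| ≤ K * ε ^ 2 ∧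
      |inner ℝ (S.normal (vertexPoint p)) (edgeVector S p c) -
        1 / 2 * (κ 0 * inner ℝ (v 0) (edgeVector S p c) ^ 2 +
          κ 1 * inner ℝ (v 1) (edgeVector S p c) ^ 2)| ≤ (K' + 2 * K ^ 2) * ε ^ 3 := by
    intro c d hcd
    obtain ⟨h1, h2, h3⟩ := hest c hcd.2.1
    rw [hv.inner_shapeOperator, mul_assoc, mul_assoc, ← pow_two, ← pow_two] at h3
    exact ⟨h1, hρ.le_mul_norm hcd, h2, h3⟩
  have hε0 : 0 ≤ ε := (norm_nonneg _).trans (hlen e f hef).1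
  have main := abs_integratedCurvature_sub_circumcentricArea_le hv.orthonormal hv.cross_eq
    hK.nonneg hρ.1.1 (hv.abs_principalCurvature_le hK 0) (hv.abs_principalCurvature_le hK 1) hs
    (e := edgeVector S p e) (f := edgeVector S p f) (g := edgeVector S p g)
    (L := K' + 2 * K ^ 2) (by
      rintro u (rfl | rfl | rfl)
      · exact hlen e f hef
      · exact hlen f e hef.symm
      · exact hlen g e heg.symm)
    (hρ.norm_mul_norm_le hef) (hρ.norm_mul_norm_le heg) hnf hng
  have hdev : |(κ 1 - κ 0) * (tangentialDeviation v (a e) (edgeVector S p e) +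
      tangentialDeviation v (a f) (edgeVector S p f) +
      tangentialDeviation v (a g) (edgeVector S p g))| =
      |κ 1 - κ 0| * (|inner ℝ (v 1) (edgeVector S p e)| + |inner ℝ (v 0) (edgeVector S p f)| +
        |inner ℝ (v 0) (edgeVector S p g)|) := by
    rw [hae, haf, hag, abs_mul]
    simp only [tangentialDeviation, if_true, one_ne_zero, if_false]
    congr 1
    exact abs_of_nonneg (by positivity)
  rw [hdev]
  exact main
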